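/- Let $N_-,N_+\ge 1$ be integers with $N:=N_-+N_+\ge 3$, and let $k_1<\dots<k_N$ be real numbers. For $\theta^0=(\theta^0_1,\dots,\theta^0_N)\in\mathbb R^N$ put \[ \theta_i(x,y,t)=-k_ix+k_i^2y-k_i^3t+\theta_i^0,\qquad f=\sum_{i=1}^N e^{\theta_i},\qquad \tau=\det\bigl(\partial_x^{a+b}f\bigr)_{0\le a,b\le N_+-1}, \] and let $u_{\theta^0}(x,y,t)=2\,\partial_x^2\log\tau$ be the corresponding $(N_-,N_+)$-soliton solution of the KP equation $(-4u_t+u_{xxx}+6uu_x)_x+3u_{yy}=0$. The graph of this solution at time $t$, in which each line soliton is drawn as a line without width, is \[ G_{\theta^0,t}=\{(x,y)\in\mathbb R^2:\ u_{s\theta^0}(sx,sy,st)\not\to 0\ \text{ as } s\to+\infty\}. \] Its intersection points (vertices) are the points of $G_{\theta^0,t}$ near which $G_{\theta^0,t}$ does not coincide with a straight line; its edges are the connected components of $G_{\theta^0,t}$ with the vertices removed; the intermediate solitons are the bounded edges. Call $(\theta^0,t)$ generic if there are no point $(x,y)$ and no four distinct indices $i,j,l,m$ with $\theta_i=\theta_j=\theta_l=\theta_m$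 at $(x,y,t)$. Then, for every generic $(\theta^0,t)$, the graph $G_{\theta^0,t}$ has exactly $2N_-N_+-N$ intersection points and exactly $3N_-N_+-2N$ intermediate solitons. Moreover, for every $\theta^0$ all but finitely many $t\in\mathbb R$ are generic, and for every $t$ the set of $\theta^0\in\mathbb R^N$ for which $(\theta^0,t)$ is generic is open and has a complement of Lebesgue measure zero. -/

import Mathlib

open Filter Topology MeasureTheory

noncomputable section

namespace KPSoliton

variable {N : ℕ}

/-- The phase `θ_i = -k_i x + k_i² y - k_i³ t + θ_i⁰`. -/
def phase (k θ₀ : Fin N → ℝ) (i : Fin N) (x y t : ℝ) : ℝ :=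
  -k i * x + k i ^ 2 * y - k i ^ 3 * t + θ₀ i

/-- `f = ∑_i exp θ_i`. -/
def expSum (k θ₀ : Fin N → ℝ) (x y t : ℝ) : ℝ :=
  ∑ i, Real.exp (phase k θ₀ i x y t)

/-- The tau-function `τ_M`: the `M × M` Hankel determinant whose `(a, b)` entry is
`∂_x^(a+b) f`, with `a, b = 0, …, M - 1`. -/
def tau (k : Fin N → ℝ) (M : ℕ) (θ₀ : Fin N → ℝ) (x y t : ℝ) : ℝ :=
  Matrix.det (Matrix.of fun a b : Fin M =>
    iteratedDeriv ((a : ℕ) + (b : ℕ)) (fun x' => expSum k θ₀ x' y t) x)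

/-- The solution `u = 2 ∂_x² log τ_M` of the KP equation. For `M = N₊` and `N = N₋ + N₊` it is
the `(N₋, N₊)`-soliton solution. -/
def solution (k : Fin N → ℝ) (M : ℕ) (θ₀ : Fin N → ℝ) (x y t : ℝ) : ℝ :=
  2 * iteratedDeriv 2 (fun x' => Real.log (tau k M θ₀ x' y t)) x

/-- The graph of the soliton solution in the `x`-`y` plane at time `t`. Line solitons are drawn as
lines without width: positions, time and phase constants (hence all the phases) are magnified by a
factor `s → ∞`, while the width of a soliton stays bounded. The graph consists of the points at
which the solution does not decay to zero in this limit. -/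
def graph (k : Fin N → ℝ) (M : ℕ) (θ₀ : Fin N → ℝ) (t : ℝ) : Set (ℝ × ℝ) :=
  {p | ¬ Tendsto (fun s : ℝ => solution k M (s • θ₀) (s * p.1) (s * p.2) (s * t)) atTop (𝓝 0)}

/-- A straight line in the plane. -/
def IsLine (L : Set (ℝ × ℝ)) : Prop :=
  ∃ a b c : ℝ, (a ≠ 0 ∨ b ≠ 0) ∧ L = {p | a * p.1 + b * p.2 = c}

/-- The intersection points (vertices) of a graph `G`: the points of `G` near which `G` is not a
single straight line. -/
def vertices (G : Set (ℝ × ℝ)) : Set (ℝ × ℝ) :=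
  {p | p ∈ G ∧ ¬ ∃ L, IsLine L ∧ ∃ U ∈ 𝓝 p, G ∩ U = L ∩ U}

/-- The edges of a graph `G`: the connected components of `G` with its vertices removed. -/
def edges (G : Set (ℝ × ℝ)) : Set (Set (ℝ × ℝ)) :=
  {e | ∃ p ∈ G \ vertices G, e = connectedComponentIn (G \ vertices G) p}

/-- The intermediate solitons: the bounded edges of the graph. -/
def intermediateSolitons (G : Set (ℝ × ℝ)) : Set (Set (ℝ × ℝ)) :=
  {e | e ∈ edges G ∧ Bornology.IsBounded e}

/-- The generic situation at time `t`: no four phases coincide at a point of the `x`-`y` plane. -/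
def IsGeneric (k θ₀ : Fin N → ℝ) (t : ℝ) : Prop :=
  ∀ i j l m : Fin N, i < j → j < l → l < m → ∀ x y : ℝ,
    ¬ (phase k θ₀ i x y t = phase k θ₀ j x y t ∧ phase k θ₀ j x y t = phase k θ₀ l x y t ∧
      phase k θ₀ l x y t = phase k θ₀ m x y t)

end KPSoliton

end

/-! Write `M = N₊`. By Cauchy–Binet, `τ` is a sum of `exp (∑_{i ∈ S} θ_i)` over the `M`-subsets `S`,
with positive squared-Vandermonde weights, so `u` is twice the variance of `∑_{i ∈ S} k_i` under
Gibbs weights. Magnification by `s` is a zero-temperature limit (`tendsto_gibbs_variance_iff`): only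
maximal selections survive, and the graph is the tropical curve on which the `M`-th and `(M+1)`-st
largest phases coincide (`mem_graph_iff`).

On the line `θ_i = θ_j`, each other `θ_l - θ_i` is affine in `y`, vanishes at the triple point with
`l`, and increases iff `l` is not between `i` and `j` (`phaseAt_linePt_sub`). Generically the triple
points on a line are distinct, and the number of phases above the line jumps by one at each. Edges
are the pieces of lines with `M - 1` phases above; vertices are the triple points with `M - 1` or `M
- 2` phases above.

Let `T_b` count the triples with `b - 1` phases above their common point. Telescoping along all
lines (`sum_level_differences`), where a triple is met twice with the third phase rising and once
with it sinking, gives `T_{b+1} = T_b + N - 2 - 2b`, so `T_b = b(N - 1 - b)`. There are `T_M +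
T_{M-1}` vertices. Likewise `2 T_M + T_{M-1}` edges have an upper endpoint, of which `N - M` are
unbounded below; the rest are the bounded edges.

Nongenericity is a finite union of coincidences of two triple points on one line. They move at
different speeds, and their coincidence at a fixed `t` is a proper affine condition on `θ⁰`. -/

namespace KPSoliton

/-! ### Cauchy–Binet for weighted Hankel matrices -/

section Determinant

/-- The Cauchy–Binet expansion of a weighted Hankel determinant, summed over all maps. -/
theorem factorial_mul_det_hankel {n M : ℕ} (v w : Fin n → ℝ) :
    (M.factorial : ℝ) *
        Matrix.det (Matrix.of fun a b : Fin M => ∑ i, v i ^ ((a : ℕ) + (b : ℕ)) * w i) =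
      ∑ f : Fin M → Fin n, Matrix.det (Matrix.vandermonde (v ∘ f)) ^ 2 * ∏ a, w (f a) := by
  set X : (Fin M → Fin n) → ℝ := fun f =>
    (∏ a : Fin M, v (f a) ^ (a : ℕ) * w (f a)) * Matrix.det (Matrix.vandermonde (v ∘ f)) with hX
  -- Multilinearity in the rows: row `a` selects an index `f a`, and extracting `v (f a) ^ a * w (f
  -- a)` leaves a Vandermonde row.
  have h1 : Matrix.det (Matrix.of fun a b : Fin M => ∑ i, v i ^ ((a : ℕ) + (b : ℕ)) * w i)
      = ∑ f, X f := by
    have h := (Matrix.detRowAlternating (n := Fin M) (R := ℝ)).toMultilinearMap.map_sum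
      (fun (a : Fin M) (i : Fin n) => fun b : Fin M => v i ^ ((a : ℕ) + (b : ℕ)) * w i)
    have h2 : (Matrix.of fun a b : Fin M => ∑ i, v i ^ ((a : ℕ) + (b : ℕ)) * w i) =
        fun a : Fin M => ∑ i, fun b : Fin M => v i ^ ((a : ℕ) + (b : ℕ)) * w i := by
      ext a b
      simp [Finset.sum_apply]
    rw [h2]
    refine h.trans (Finset.sum_congr rfl fun f _ => ?_)
    rw [hX]
    simp only
    rw [← Matrix.det_mul_column]
    refine congrArg Matrix.det ?_
    ext a b
    simp [Matrix.vandermonde_apply, pow_add]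
    ring
  -- Summing over all relabellings `f ∘ σ` produces `M!` and antisymmetrizes the extracted powers
  -- into a second Vandermonde determinant.
  have h3 : ∀ σ : Equiv.Perm (Fin M), ∑ f, X f = ∑ f, X (f ∘ σ) := fun σ =>
    (Fintype.sum_equiv (Equiv.arrowCongr σ.symm (Equiv.refl (Fin n))) _ _ (fun f => by
      simp [Equiv.arrowCongr, Function.comp_def])).symm
  have h4 : (M.factorial : ℝ) * ∑ f, X f = ∑ σ : Equiv.Perm (Fin M), ∑ f, X (f ∘ σ) := by
    rw [← Finset.sum_congr rfl fun σ _ => h3 σ, Finset.sum_const, Finset.card_univ,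
      Fintype.card_perm, Fintype.card_fin, nsmul_eq_mul]
  rw [h1, h4, Finset.sum_comm]
  refine Finset.sum_congr rfl fun f _ => ?_
  have h5 : ∀ σ : Equiv.Perm (Fin M), X (f ∘ σ) =
      (∏ a, w (f a)) * Matrix.det (Matrix.vandermonde (v ∘ f)) *
        ((Equiv.Perm.sign σ : ℤ) * ∏ a, Matrix.vandermonde (v ∘ f) (σ a) a) := by
    intro σ
    have h6 : Matrix.det (Matrix.vandermonde (v ∘ (f ∘ σ))) =
        (Equiv.Perm.sign σ : ℤ) * Matrix.det (Matrix.vandermonde (v ∘ f)) :=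
      Matrix.det_permute σ (Matrix.vandermonde (v ∘ f))
    rw [hX]
    simp only
    rw [h6, Finset.prod_mul_distrib]
    have h7 : ∏ a, w ((f ∘ σ) a) = ∏ a, w (f a) := Equiv.prod_comp σ fun a => w (f a)
    rw [h7]
    simp only [Matrix.vandermonde_apply, Function.comp_apply]
    ring
  rw [Finset.sum_congr rfl fun σ _ => h5 σ, ← Finset.mul_sum, ← Matrix.det_apply']
  ring

end Determinant

/-! ### The second logarithmic derivative as a Gibbs variance, and its zero-temperature limit -/

section LogSecondDerivative

variable {ι : Type*} [Fintype ι]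

theorem hasDerivAt_sum_exp (c a K : ι → ℝ) (x : ℝ) :
    HasDerivAt (fun x => ∑ i, c i * Real.exp (a i - K i * x))
      (∑ i, (-(K i) * c i) * Real.exp (a i - K i * x)) x := by
  refine (HasDerivAt.fun_sum fun i _ => ((((hasDerivAt_id x).const_mul (K i)).const_sub
    (a i)).exp.const_mul (c i))).congr_deriv (Finset.sum_congr rfl fun i _ => ?_)
  simp
  ring

/-- `(log Z)''` is the variance of `K` under the weights `c i * exp (a i - K i * x) / Z`. The factor
2 turns it into a sum over ordered pairs, whose terms are all nonnegative when `c ≥ 0`. -/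
theorem two_mul_iteratedDeriv_log_sum_exp (c a K : ι → ℝ)
    (hpos : ∀ x, 0 < ∑ i, c i * Real.exp (a i - K i * x)) (x : ℝ) :
    2 * iteratedDeriv 2 (fun x => Real.log (∑ i, c i * Real.exp (a i - K i * x))) x =
      (∑ i, ∑ j, c i * c j * (K i - K j) ^ 2 *
        (Real.exp (a i - K i * x) * Real.exp (a j - K j * x))) /
        (∑ i, c i * Real.exp (a i - K i * x)) ^ 2 := by
  have h1 : deriv (fun x => Real.log (∑ i, c i * Real.exp (a i - K i * x))) =
      fun x => (∑ i, (-(K i) * c i) * Real.exp (a i - K i * x)) /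
        (∑ i, c i * Real.exp (a i - K i * x)) := by
    funext x
    exact ((hasDerivAt_sum_exp c a K x).log (hpos x).ne').deriv
  rw [iteratedDeriv_succ, iteratedDeriv_one, h1,
    ((hasDerivAt_sum_exp (fun i => -(K i) * c i) a K x).fun_div (hasDerivAt_sum_exp c a K x)
      (hpos x).ne').deriv, ← mul_div_assoc]
  congr 1
  set E : ι → ℝ := fun i => Real.exp (a i - K i * x)
  have h2 : ∀ p q : ι → ℝ, (∑ i, p i) * ∑ j, q j = ∑ i, ∑ j, p i * q j := fun p q =>
    Finset.sum_mul_sum _ _ _ _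
  have h3 : ∑ i, ∑ j, c i * c j * (K i - K j) ^ 2 * (E i * E j) =
      (∑ i, ∑ j, (K i ^ 2 * c i * E i) * (c j * E j)) +
        (∑ i, ∑ j, (c i * E i) * (K j ^ 2 * c j * E j)) -
        2 * ∑ i, ∑ j, (K i * c i * E i) * (K j * c j * E j) := by
    simp only [Finset.mul_sum, ← Finset.sum_add_distrib, ← Finset.sum_sub_distrib]
    exact Finset.sum_congr rfl fun i _ => Finset.sum_congr rfl fun j _ => by ring
  rw [h3, ← h2, ← h2, ← h2]
  have h4 : ∑ i, -K i * (-K i * c i) * E i = ∑ i, K i ^ 2 * c i * E i :=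
    Finset.sum_congr rfl fun i _ => by ring
  have h5 : ∑ i, -K i * c i * E i = -∑ i, K i * c i * E i := by
    rw [← Finset.sum_neg_distrib]
    exact Finset.sum_congr rfl fun i _ => by ring
  rw [h4, h5]
  ring

/-- The variance of `K` under the Gibbs weights `c i * exp (s * a i)` tends to `0` as `s → ∞` iff
`K` is constant on the maximizers of `a`. -/
theorem tendsto_gibbs_variance_iff (c a K : ι → ℝ) (hc : ∀ i, 0 ≤ c i) (hne : ∃ i, 0 < c i) :
    Tendsto (fun s : ℝ => (∑ i, ∑ j, c i * c j * (K i - K j) ^ 2 *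
        (Real.exp (s * a i) * Real.exp (s * a j))) / (∑ i, c i * Real.exp (s * a i)) ^ 2)
        atTop (𝓝 0) ↔
      ∀ i j, 0 < c i → 0 < c j → (∀ l, 0 < c l → a l ≤ a i) → (∀ l, 0 < c l → a l ≤ a j) →
        K i = K j := by
  classical
  have hterm : ∀ s i j, 0 ≤ c i * c j * (K i - K j) ^ 2 *
      (Real.exp (s * a i) * Real.exp (s * a j)) := fun s i j =>
    mul_nonneg (mul_nonneg (mul_nonneg (hc i) (hc j)) (sq_nonneg _)) (by positivity)
  constructor
  · intro h i j hi hj hmi hmj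
    by_contra hK
    have haij : a i = a j := le_antisymm (hmj i hi) (hmi j hj)
    have hC : 0 < ∑ l, c l := Finset.sum_pos' (fun l _ => hc l) ⟨i, Finset.mem_univ _, hi⟩
    -- Keep only the pair `(i, j)` in the numerator and replace every exponential in the denominator
    -- by the maximal one; the exponentials then cancel.
    set δ : ℝ := c i * c j * (K i - K j) ^ 2 / (∑ l, c l) ^ 2 with hδ
    have hδpos : 0 < δ := by
      have : 0 < (K i - K j) ^ 2 := by
        have := sub_ne_zero.2 hK
        positivity
      positivity
    have hbound : ∀ s : ℝ, 0 ≤ s → δ ≤ (∑ i, ∑ j, c i * c j * (K i - K j) ^ 2 *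
        (Real.exp (s * a i) * Real.exp (s * a j))) / (∑ i, c i * Real.exp (s * a i)) ^ 2 := by
      intro s hs
      have hden : ∑ l, c l * Real.exp (s * a l) ≤ (∑ l, c l) * Real.exp (s * a i) := by
        rw [Finset.sum_mul]
        refine Finset.sum_le_sum fun l _ => ?_
        rcases (hc l).eq_or_lt with h0 | h0
        · simp [← h0]
        · exact mul_le_mul_of_nonneg_left
            (Real.exp_le_exp.2 (mul_le_mul_of_nonneg_left (hmi l h0) hs)) h0.le
      have hdpos : 0 < ∑ l, c l * Real.exp (s * a l) :=
        Finset.sum_pos' (fun l _ => mul_nonneg (hc l) (Real.exp_pos _).le)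
          ⟨i, Finset.mem_univ _, mul_pos hi (Real.exp_pos _)⟩
      have hnum : c i * c j * (K i - K j) ^ 2 * (Real.exp (s * a i) * Real.exp (s * a i)) ≤
          ∑ i, ∑ j, c i * c j * (K i - K j) ^ 2 *
            (Real.exp (s * a i) * Real.exp (s * a j)) := by
        refine le_trans ?_ (Finset.single_le_sum
          (fun l _ => Finset.sum_nonneg fun m _ => hterm s l m) (Finset.mem_univ i))
        refine le_trans ?_ (Finset.single_le_sum
          (fun m _ => hterm s i m) (Finset.mem_univ j))
        rw [haij]
      rw [hδ, div_le_div_iff₀ (by positivity) (by positivity)]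
      have hsq : (∑ l, c l * Real.exp (s * a l)) ^ 2 ≤
          ((∑ l, c l) * Real.exp (s * a i)) ^ 2 := pow_le_pow_left₀ hdpos.le hden 2
      have hnn : 0 ≤ c i * c j * (K i - K j) ^ 2 := by positivity
      calc c i * c j * (K i - K j) ^ 2 * (∑ l, c l * Real.exp (s * a l)) ^ 2
          ≤ c i * c j * (K i - K j) ^ 2 * ((∑ l, c l) * Real.exp (s * a i)) ^ 2 :=
            mul_le_mul_of_nonneg_left hsq hnn
        _ = c i * c j * (K i - K j) ^ 2 * (Real.exp (s * a i) * Real.exp (s * a i)) *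
              (∑ l, c l) ^ 2 := by ring
        _ ≤ _ := mul_le_mul_of_nonneg_right hnum (by positivity)
    exact absurd (ge_of_tendsto h ((eventually_ge_atTop 0).mono hbound)) (not_le.2 hδpos)
  · intro h
    obtain ⟨i₁, hi₁⟩ := hne
    obtain ⟨i₀, hi₀, hmax⟩ := Finset.exists_max_image (Finset.univ.filter fun i => 0 < c i) a
      ⟨i₁, by simpa using hi₁⟩
    have hi₀ : 0 < c i₀ := by simpa using hi₀
    have hmax : ∀ l, 0 < c l → a l ≤ a i₀ := fun l hl => hmax l (by simpa using hl)
    -- Bounding the denominator below by its `i₀` term leaves exponents `≤ 0`. An exponent is zero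
    -- only when `i` and `j` are both maximizers, and then `K i = K j` kills the coefficient.
    have key : Tendsto (fun s : ℝ => ∑ i, ∑ j, c i * c j * (K i - K j) ^ 2 / c i₀ ^ 2 *
        Real.exp (s * (a i + a j - 2 * a i₀))) atTop (𝓝 0) := by
      have : (0 : ℝ) = ∑ i : ι, ∑ j : ι, (0 : ℝ) := by simp
      rw [this]
      refine tendsto_finsetSum _ fun i _ => tendsto_finsetSum _ fun j _ => ?_
      by_cases hz : c i * c j * (K i - K j) ^ 2 = 0
      · simp [hz]
      have hci : 0 < c i := lt_of_le_of_ne (hc i) fun h0 => hz (by simp [← h0])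
      have hcj : 0 < c j := lt_of_le_of_ne (hc j) fun h0 => hz (by simp [← h0])
      have hlt : a i + a j - 2 * a i₀ < 0 := by
        by_contra hcon
        have h1 := hmax i hci
        have h2 := hmax j hcj
        refine hz ?_
        rw [h i j hci hcj (fun l hl => ?_) (fun l hl => ?_)]
        · simp
        · have := hmax l hl; linarith
        · have := hmax l hl; linarith
      have := (Real.tendsto_exp_atBot.comp
        (tendsto_id.atTop_mul_const_of_neg hlt)).const_mul (c i * c j * (K i - K j) ^ 2 / c i₀ ^ 2)
      simpa using this
    refine tendsto_of_tendsto_of_tendsto_of_le_of_le tendsto_const_nhds key (fun s => ?_)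
      (fun s => ?_)
    · exact div_nonneg (Finset.sum_nonneg fun i _ => Finset.sum_nonneg fun j _ => hterm s i j)
        (sq_nonneg _)
    · have hle : c i₀ * Real.exp (s * a i₀) ≤ ∑ l, c l * Real.exp (s * a l) :=
        Finset.single_le_sum (f := fun l => c l * Real.exp (s * a l))
          (fun l _ => mul_nonneg (hc l) (Real.exp_pos _).le) (Finset.mem_univ i₀)
      have hpos : 0 < c i₀ * Real.exp (s * a i₀) := by positivity
      refine (div_le_div_of_nonneg_left (Finset.sum_nonneg fun i _ =>
        Finset.sum_nonneg fun j _ => hterm s i j) (by positivity)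
        (pow_le_pow_left₀ hpos.le hle 2)).trans (le_of_eq ?_)
      rw [Finset.sum_div]
      refine Finset.sum_congr rfl fun i _ => ?_
      rw [Finset.sum_div]
      refine Finset.sum_congr rfl fun j _ => ?_
      have he : s * (a i + a j - 2 * a i₀) = s * a i + s * a j - (s * a i₀ + s * a i₀) := by ring
      rw [he, Real.exp_sub, Real.exp_add, Real.exp_add]
      have := (Real.exp_pos (s * a i₀)).ne'
      field_simp

end LogSecondDerivative

/-! ### The graph as a tropical curve -/

section Graph

variable {N : ℕ}

theorem iteratedDeriv_sum_exp {ι : Type*} [Fintype ι] (b K : ι → ℝ) (n : ℕ) :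
    iteratedDeriv n (fun x => ∑ i, Real.exp (b i - K i * x)) =
      fun x => ∑ i, (-(K i)) ^ n * Real.exp (b i - K i * x) := by
  induction n with
  | zero => simp
  | succ n ih =>
    rw [iteratedDeriv_succ, ih]
    funext x
    rw [(hasDerivAt_sum_exp (fun i => (-(K i)) ^ n) b K x).deriv]
    exact Finset.sum_congr rfl fun i _ => by ring

/-- The coefficient of `exp (∑ a, θ (f a))` in the tau-function. -/
noncomputable def tauCoeff (k : Fin N → ℝ) {M : ℕ} (f : Fin M → Fin N) : ℝ :=
  Matrix.det (Matrix.vandermonde ((fun i => -(k i)) ∘ f)) ^ 2 / (M.factorial : ℝ)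

theorem tauCoeff_nonneg (k : Fin N → ℝ) {M : ℕ} (f : Fin M → Fin N) : 0 ≤ tauCoeff k f :=
  div_nonneg (sq_nonneg _) (Nat.cast_nonneg _)

theorem tauCoeff_pos_iff {k : Fin N → ℝ} (hk : Function.Injective k) {M : ℕ}
    (f : Fin M → Fin N) : 0 < tauCoeff k f ↔ Function.Injective f := by
  have hM : (0 : ℝ) < M.factorial := Nat.cast_pos.2 M.factorial_pos
  have hinj : Function.Injective fun i => -(k i) := neg_injective.comp hk
  rw [tauCoeff, div_pos_iff_of_pos_right hM, sq_pos_iff, Matrix.det_vandermonde_ne_zero_iff,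
    hinj.of_comp_iff]

/-- Each `x`-derivative of `exp θ_i` brings down `-k i`, so the matrix is a weighted Hankel matrix
with nodes `-k i`. The exponent is split as `a f - K f * x` with `K f = ∑ k (f a)`, ready for
differentiation in `x`. -/
theorem tau_eq_sum (k : Fin N → ℝ) (M : ℕ) (θ₀ : Fin N → ℝ) (x y t : ℝ) :
    tau k M θ₀ x y t = ∑ f : Fin M → Fin N, tauCoeff k f *
      Real.exp (∑ a, (k (f a) ^ 2 * y - k (f a) ^ 3 * t + θ₀ (f a)) - (∑ a, k (f a)) * x) := by
  have h1 : (fun x' => expSum k θ₀ x' y t) =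
      fun x' => ∑ i, Real.exp ((k i ^ 2 * y - k i ^ 3 * t + θ₀ i) - k i * x') := by
    funext x'
    exact Finset.sum_congr rfl fun i _ => by rw [phase]; ring_nf
  have hM : (0 : ℝ) < M.factorial := Nat.cast_pos.2 M.factorial_pos
  have h2 := factorial_mul_det_hankel (M := M) (fun i => -(k i))
    (fun i => Real.exp ((k i ^ 2 * y - k i ^ 3 * t + θ₀ i) - k i * x))
  rw [tau, h1]
  simp only [iteratedDeriv_sum_exp]
  rw [← mul_right_inj' hM.ne', h2, Finset.mul_sum]
  refine Finset.sum_congr rfl fun f _ => ?_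
  rw [tauCoeff, ← Real.exp_sum, Finset.sum_sub_distrib, ← Finset.sum_mul,
    ← mul_assoc, mul_div_cancel₀ _ hM.ne']

theorem solution_eq (k : Fin N → ℝ) (hk : Function.Injective k) {M : ℕ} (hM : M ≤ N)
    (θ₀ : Fin N → ℝ) (x y t : ℝ) :
    solution k M θ₀ x y t =
      (∑ f : Fin M → Fin N, ∑ g : Fin M → Fin N, tauCoeff k f * tauCoeff k g *
        (∑ a, k (f a) - ∑ a, k (g a)) ^ 2 *
        (Real.exp (∑ a, phase k θ₀ (f a) x y t) * Real.exp (∑ a, phase k θ₀ (g a) x y t))) /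
      (∑ f : Fin M → Fin N, tauCoeff k f * Real.exp (∑ a, phase k θ₀ (f a) x y t)) ^ 2 := by
  have hph : ∀ f : Fin M → Fin N, ∑ a, phase k θ₀ (f a) x y t =
      ∑ a, (k (f a) ^ 2 * y - k (f a) ^ 3 * t + θ₀ (f a)) - (∑ a, k (f a)) * x := by
    intro f
    rw [Finset.sum_mul, ← Finset.sum_sub_distrib]
    exact Finset.sum_congr rfl fun a _ => by rw [phase]; ring
  simp only [hph, solution, tau_eq_sum]
  refine two_mul_iteratedDeriv_log_sum_exp (tauCoeff k) _ (fun f => ∑ a, k (f a)) (fun x => ?_) x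
  exact Finset.sum_pos' (fun f _ => mul_nonneg (tauCoeff_nonneg k f) (Real.exp_pos _).le)
    ⟨Fin.castLE hM, Finset.mem_univ _,
      mul_pos ((tauCoeff_pos_iff hk _).2 (Fin.castLE_injective hM)) (Real.exp_pos _)⟩

/-- Homogeneity of degree one: the magnification factor `s` becomes the inverse temperature of the
Gibbs weights. -/
theorem phase_smul (k θ₀ : Fin N → ℝ) (i : Fin N) (s x y t : ℝ) :
    phase k (s • θ₀) i (s * x) (s * y) (s * t) = s * phase k θ₀ i x y t := by
  simp only [phase, Pi.smul_apply, smul_eq_mul]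
  ring

/-- `f` is injective and its image has maximal total weight. -/
def IsMaxSelection {M : ℕ} (φ : Fin N → ℝ) (f : Fin M → Fin N) : Prop :=
  Function.Injective f ∧
    ∀ g : Fin M → Fin N, Function.Injective g → ∑ a, φ (g a) ≤ ∑ a, φ (f a)

theorem mem_graph_iff_selection {k : Fin N → ℝ} (hk : Function.Injective k) {M : ℕ} (hM : M ≤ N)
    (θ₀ : Fin N → ℝ) (t : ℝ) (p : ℝ × ℝ) :
    p ∈ graph k M θ₀ t ↔ ∃ f g : Fin M → Fin N,
      IsMaxSelection (fun i => phase k θ₀ i p.1 p.2 t) f ∧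
      IsMaxSelection (fun i => phase k θ₀ i p.1 p.2 t) g ∧ ∑ a, k (f a) ≠ ∑ a, k (g a) := by
  have h := tendsto_gibbs_variance_iff (tauCoeff k (M := M))
    (fun f => ∑ a, phase k θ₀ (f a) p.1 p.2 t) (fun f => ∑ a, k (f a)) (tauCoeff_nonneg k)
    ⟨Fin.castLE hM, (tauCoeff_pos_iff hk _).2 (Fin.castLE_injective hM)⟩
  simp only [tauCoeff_pos_iff hk] at h
  simp only [graph, Set.mem_ofPred_eq, solution_eq k hk hM, phase_smul, ← Finset.mul_sum]
  rw [h]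
  push Not
  constructor
  · rintro ⟨f, g, hf, hg, hmf, hmg, hne⟩
    exact ⟨f, g, ⟨hf, hmf⟩, ⟨hg, hmg⟩, hne⟩
  · rintro ⟨f, g, ⟨hf, hmf⟩, ⟨hg, hmg⟩, hne⟩
    exact ⟨f, g, hf, hg, hmf, hmg, hne⟩

theorem exists_injective_image_eq {M : ℕ} {S : Finset (Fin N)} (hS : S.card = M) :
    ∃ f : Fin M → Fin N, Function.Injective f ∧ ∀ w : Fin N → ℝ, ∑ a, w (f a) = ∑ i ∈ S, w i := by
  refine ⟨S.orderEmbOfFin hS, (S.orderEmbOfFin hS).injective, fun w => ?_⟩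
  have h : Finset.univ.image (S.orderEmbOfFin hS) = S := by simp
  conv_rhs => rw [← h]
  rw [Finset.sum_image fun _ _ _ _ hab => (S.orderEmbOfFin hS).injective hab]

theorem sum_image_univ_of_injective {M : ℕ} {f : Fin M → Fin N} (hf : Function.Injective f)
    (w : Fin N → ℝ) : ∑ i ∈ Finset.univ.image f, w i = ∑ a, w (f a) :=
  Finset.sum_image fun _ _ _ _ hab => hf hab

/-- Exchange argument: swapping `i` for `j` in the image cannot increase the total weight. -/
theorem IsMaxSelection.le_of_mem {M : ℕ} {φ : Fin N → ℝ} {f : Fin M → Fin N}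
    (hf : IsMaxSelection φ f) {i j : Fin N} (hi : i ∈ Finset.univ.image f)
    (hj : j ∉ Finset.univ.image f) : φ j ≤ φ i := by
  have hcard : (Finset.univ.image f).card = M := by
    rw [Finset.card_image_of_injective _ hf.1, Finset.card_univ, Fintype.card_fin]
  have hj' : j ∉ (Finset.univ.image f).erase i := fun h => hj (Finset.mem_of_mem_erase h)
  have hM : 0 < M := hcard ▸ Finset.card_pos.2 ⟨i, hi⟩
  obtain ⟨g, hg, hsum⟩ := exists_injective_image_eq (M := M)
    (S := insert j ((Finset.univ.image f).erase i)) (by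
      rw [Finset.card_insert_of_notMem hj', Finset.card_erase_of_mem hi, hcard]
      omega)
  have h1 := hf.2 g hg
  rw [hsum, Finset.sum_insert hj', ← sum_image_univ_of_injective hf.1,
    ← Finset.add_sum_erase _ φ hi] at h1
  linarith

/-- The maximal selections do not all have the same sum of `k` iff the `M`-th and the `(M+1)`-st
largest weights coincide. -/
theorem exists_selection_ne_iff {k : Fin N → ℝ} (hk : Function.Injective k) {M : ℕ}
    (φ : Fin N → ℝ) :
    (∃ f g : Fin M → Fin N, IsMaxSelection φ f ∧ IsMaxSelection φ g ∧
      ∑ a, k (f a) ≠ ∑ a, k (g a)) ↔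
    ∃ i j, i ≠ j ∧ φ i = φ j ∧ (Finset.univ.filter fun m => φ i < φ m).card < M ∧
      M < (Finset.univ.filter fun m => φ i ≤ φ m).card := by
  constructor
  · rintro ⟨f, g, hf, hg, hne⟩
    have hcf : (Finset.univ.image f).card = M := by
      rw [Finset.card_image_of_injective _ hf.1, Finset.card_univ, Fintype.card_fin]
    have hcg : (Finset.univ.image g).card = M := by
      rw [Finset.card_image_of_injective _ hg.1, Finset.card_univ, Fintype.card_fin]
    have hST : Finset.univ.image f ≠ Finset.univ.image g := fun h => hne (by
      rw [← sum_image_univ_of_injective hf.1, h, sum_image_univ_of_injective hg.1])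
    obtain ⟨i, hiS, hiT⟩ := Finset.not_subset.1 fun h : Finset.univ.image f ⊆ Finset.univ.image g =>
      hST (Finset.eq_of_subset_of_card_le h (by rw [hcf, hcg]))
    obtain ⟨j, hjT, hjS⟩ := Finset.not_subset.1 fun h : Finset.univ.image g ⊆ Finset.univ.image f =>
      hST (Finset.eq_of_subset_of_card_le h (by rw [hcf, hcg])).symm
    have hij : φ i = φ j := le_antisymm (hg.le_of_mem hjT hiT) (hf.le_of_mem hiS hjS)
    refine ⟨i, j, fun h => hjS (h ▸ hiS), hij, ?_, ?_⟩
    · rw [← hcf]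
      refine Finset.card_lt_card ⟨fun m hm => ?_, fun h => ?_⟩
      · by_contra hmS
        exact absurd (Finset.mem_filter.1 hm).2 (not_lt.2 (hf.le_of_mem hiS hmS))
      · exact lt_irrefl _ (Finset.mem_filter.1 (h hiS)).2
    · rw [← hcf]
      refine Finset.card_lt_card ⟨fun m hm => ?_, fun h => hjS (h ?_)⟩
      · exact Finset.mem_filter.2 ⟨Finset.mem_univ _, hij ▸ hf.le_of_mem hm hjS⟩
      · exact Finset.mem_filter.2 ⟨Finset.mem_univ _, hij.le⟩
  · rintro ⟨i, j, hij, hφ, hlt, hgt⟩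
    set A := Finset.univ.filter fun m => φ i < φ m with hA
    set B := Finset.univ.filter fun m => φ i ≤ φ m with hB
    have hiB : i ∈ B := by simp [hB]
    have hjB : j ∈ B.erase i := by simp [hB, hij.symm, hφ.le]
    have hAB : A ⊆ (B.erase i).erase j := by
      intro m hm
      have hm' : φ i < φ m := (Finset.mem_filter.1 hm).2
      refine Finset.mem_erase.2 ⟨?_, Finset.mem_erase.2 ⟨?_, by simp [hB, hm'.le]⟩⟩
      · rintro rfl
        exact hm'.ne hφ
      · rintro rfl
        exact lt_irrefl _ hm'
    -- `C` holds everything strictly above the tied value and is completed by tied indices to size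
    -- `M - 1`, avoiding `i` and `j`. Then `C ∪ {i}` and `C ∪ {j}` are both optimal and differ in
    -- their sum of `k`.
    obtain ⟨C, hAC, hCB, hC⟩ := Finset.exists_subsuperset_card_eq (n := M - 1) hAB (by omega) (by
      rw [Finset.card_erase_of_mem hjB, Finset.card_erase_of_mem hiB]; omega)
    have hiC : i ∉ C := fun h => by simpa using hCB h
    have hjC : j ∉ C := fun h => by simpa using hCB h
    have hmax : ∀ l ∉ C, φ l = φ i → ∀ g : Fin M → Fin N, Function.Injective g →
        ∑ a, φ (g a) ≤ ∑ m ∈ insert l C, φ m := by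
      intro l hl hli g hg
      have hcg : (Finset.univ.image g).card = (insert l C).card := by
        rw [Finset.card_image_of_injective _ hg, Finset.card_univ, Fintype.card_fin,
          Finset.card_insert_of_notMem hl, hC]
        omega
      -- Relative to the tied value, any selection is bounded by the sum of all positive parts.
      -- `insert l C` attains this bound, since it contains `A` and lies in `B`.
      have h1 : ∑ m ∈ Finset.univ.image g, (φ m - φ i) ≤ ∑ m ∈ insert l C, (φ m - φ i) := by
        calc ∑ m ∈ Finset.univ.image g, (φ m - φ i)
            ≤ ∑ m ∈ Finset.univ.image g, max (φ m - φ i) 0 :=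
              Finset.sum_le_sum fun m _ => le_max_left _ _
          _ ≤ ∑ m, max (φ m - φ i) 0 :=
              Finset.sum_le_sum_of_subset_of_nonneg (Finset.subset_univ _)
                fun m _ _ => le_max_right _ _
          _ = ∑ m ∈ insert l C, max (φ m - φ i) 0 := by
              refine (Finset.sum_subset (Finset.subset_univ _) fun m _ hm => ?_).symm
              refine max_eq_right (sub_nonpos.2 (not_lt.1 fun hlt => hm ?_))
              exact Finset.mem_insert_of_mem (hAC (by simp [hA, hlt]))
          _ = ∑ m ∈ insert l C, (φ m - φ i) := by
              refine Finset.sum_congr rfl fun m hm => max_eq_left (sub_nonneg.2 ?_)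
              rcases Finset.mem_insert.1 hm with rfl | hm
              · exact hli.ge
              · exact (Finset.mem_filter.1
                  (Finset.mem_of_mem_erase (Finset.mem_of_mem_erase (hCB hm)))).2
      rw [Finset.sum_sub_distrib, Finset.sum_sub_distrib, Finset.sum_const, Finset.sum_const, hcg,
        sum_image_univ_of_injective hg] at h1
      linarith
    have hcard : ∀ l ∉ C, (insert l C).card = M := fun l hl => by
      rw [Finset.card_insert_of_notMem hl, hC]; omega
    obtain ⟨f, hf, hfs⟩ := exists_injective_image_eq (hcard i hiC)
    obtain ⟨g, hg, hgs⟩ := exists_injective_image_eq (hcard j hjC)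
    refine ⟨f, g, ⟨hf, fun u hu => ?_⟩, ⟨hg, fun u hu => ?_⟩, ?_⟩
    · rw [hfs]; exact hmax i hiC rfl u hu
    · rw [hgs]; exact hmax j hjC hφ.symm u hu
    · rw [hfs, hgs, Finset.sum_insert hiC, Finset.sum_insert hjC]
      exact fun h => hij (hk (by linarith))

/-- The graph consists of the points at which the `M`-th and the `(M+1)`-st largest phases
coincide. -/
theorem mem_graph_iff {k : Fin N → ℝ} (hk : Function.Injective k) {M : ℕ} (hM : M ≤ N)
    (θ₀ : Fin N → ℝ) (t : ℝ) (p : ℝ × ℝ) :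
    p ∈ graph k M θ₀ t ↔ ∃ i j, i ≠ j ∧ phase k θ₀ i p.1 p.2 t = phase k θ₀ j p.1 p.2 t ∧
      (Finset.univ.filter fun m => phase k θ₀ i p.1 p.2 t < phase k θ₀ m p.1 p.2 t).card < M ∧
      M < (Finset.univ.filter fun m =>
        phase k θ₀ i p.1 p.2 t ≤ phase k θ₀ m p.1 p.2 t).card := by
  rw [mem_graph_iff_selection hk hM,
    exists_selection_ne_iff hk (fun i => phase k θ₀ i p.1 p.2 t)]

end Graph

/-! ### Lines of equal phases and their triple points -/

section Geometry

variable {N : ℕ}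

/-- The values of the phases at a point of the plane. -/
def phaseAt (k θ₀ : Fin N → ℝ) (t : ℝ) (p : ℝ × ℝ) (i : Fin N) : ℝ := phase k θ₀ i p.1 p.2 t

/-- The phases that exceed `θ_i` at `p`. -/
noncomputable def above (k θ₀ : Fin N → ℝ) (t : ℝ) (p : ℝ × ℝ) (i : Fin N) : Finset (Fin N) :=
  Finset.univ.filter fun m => phaseAt k θ₀ t p i < phaseAt k θ₀ t p m

/-- The point with ordinate `y` on the line `θ_i = θ_j`. -/
noncomputable def linePt (k θ₀ : Fin N → ℝ) (t : ℝ) (i j : Fin N) (y : ℝ) : ℝ × ℝ :=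
  ((k i + k j) * y + ((θ₀ j - k j ^ 3 * t) - (θ₀ i - k i ^ 3 * t)) / (k j - k i), y)

/-- The ordinate of the point at which `θ_i = θ_j = θ_l`. -/
noncomputable def tripleY (k θ₀ : Fin N → ℝ) (t : ℝ) (i j l : Fin N) : ℝ :=
  -((θ₀ i - k i ^ 3 * t) / ((k i - k j) * (k i - k l)) +
    (θ₀ j - k j ^ 3 * t) / ((k j - k i) * (k j - k l)) +
    (θ₀ l - k l ^ 3 * t) / ((k l - k i) * (k l - k j)))

/-- The point at which `θ_i = θ_j = θ_l`. -/
noncomputable def triplePt (k θ₀ : Fin N → ℝ) (t : ℝ) (i j l : Fin N) : ℝ × ℝ :=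
  linePt k θ₀ t i j (tripleY k θ₀ t i j l)

variable {k θ₀ : Fin N → ℝ} {t : ℝ}

theorem phaseAt_eq_iff (hk : Function.Injective k) {i j : Fin N} (hij : i ≠ j) (p : ℝ × ℝ) :
    phaseAt k θ₀ t p i = phaseAt k θ₀ t p j ↔ p = linePt k θ₀ t i j p.2 := by
  have h : k j - k i ≠ 0 := sub_ne_zero.2 fun h => hij (hk h.symm)
  rw [Prod.ext_iff]
  simp only [linePt, phaseAt, phase, and_true]
  constructor
  · intro h1
    field_simp
    linear_combination h1
  · intro h1
    field_simp at h1
    linear_combination h1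

theorem phaseAt_linePt (hk : Function.Injective k) {i j : Fin N} (hij : i ≠ j) (y : ℝ) :
    phaseAt k θ₀ t (linePt k θ₀ t i j y) i = phaseAt k θ₀ t (linePt k θ₀ t i j y) j :=
  (phaseAt_eq_iff hk hij _).2 rfl

/-- The line has direction `(k i + k j, 1)`, along which `θ_l - θ_i` has slope `(k l - k i) * (k l -
k j)`. `tripleY` is minus the second divided difference of `θ⁰ - k³ t` at the nodes `k i`, `k j`, `k
l`. -/
theorem phaseAt_linePt_sub (hk : Function.Injective k) {i j l : Fin N} (hij : i ≠ j) (hil : l ≠ i)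
    (hjl : l ≠ j) (y : ℝ) :
    phaseAt k θ₀ t (linePt k θ₀ t i j y) l - phaseAt k θ₀ t (linePt k θ₀ t i j y) i =
      (k l - k i) * (k l - k j) * (y - tripleY k θ₀ t i j l) := by
  have h1 : k j - k i ≠ 0 := sub_ne_zero.2 fun h => hij (hk h.symm)
  have h2 : k l - k i ≠ 0 := sub_ne_zero.2 fun h => hil (hk h)
  have h3 : k l - k j ≠ 0 := sub_ne_zero.2 fun h => hjl (hk h)
  have e1 : k i - k j = -(k j - k i) := by ring
  have e2 : k i - k l = -(k l - k i) := by ring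
  have e3 : k j - k l = -(k l - k j) := by ring
  simp only [linePt, phaseAt, phase, tripleY]
  rw [e1, e2, e3]
  field_simp
  ring

theorem phaseAt_triplePt (hk : Function.Injective k) {i j l : Fin N} (hij : i ≠ j) (hil : l ≠ i)
    (hjl : l ≠ j) :
    phaseAt k θ₀ t (triplePt k θ₀ t i j l) i = phaseAt k θ₀ t (triplePt k θ₀ t i j l) j ∧
      phaseAt k θ₀ t (triplePt k θ₀ t i j l) i = phaseAt k θ₀ t (triplePt k θ₀ t i j l) l := by
  refine ⟨phaseAt_linePt hk hij _, ?_⟩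
  have h := phaseAt_linePt_sub (θ₀ := θ₀) (t := t) hk hij hil hjl (tripleY k θ₀ t i j l)
  rw [sub_self, mul_zero] at h
  exact (sub_eq_zero.1 h).symm

theorem eq_triplePt (hk : Function.Injective k) {i j l : Fin N} (hij : i ≠ j) (hil : l ≠ i)
    (hjl : l ≠ j) {p : ℝ × ℝ} (h1 : phaseAt k θ₀ t p i = phaseAt k θ₀ t p j)
    (h2 : phaseAt k θ₀ t p i = phaseAt k θ₀ t p l) : p = triplePt k θ₀ t i j l := by
  have hp := (phaseAt_eq_iff hk hij p).1 h1
  have h := phaseAt_linePt_sub (θ₀ := θ₀) (t := t) hk hij hil hjl p.2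
  rw [← hp, h2, sub_self, eq_comm, mul_eq_zero, mul_eq_zero] at h
  have h3 : p.2 = tripleY k θ₀ t i j l := by
    rcases h with (h | h) | h
    · exact absurd (hk (sub_eq_zero.1 h)) hil
    · exact absurd (hk (sub_eq_zero.1 h)) hjl
    · exact sub_eq_zero.1 h
  rw [hp, h3, triplePt]

theorem triplePt_swap (hk : Function.Injective k) {i j l : Fin N} (hij : i ≠ j) (hil : l ≠ i)
    (hjl : l ≠ j) : triplePt k θ₀ t j i l = triplePt k θ₀ t i j l := by
  obtain ⟨h1, h2⟩ := phaseAt_triplePt (θ₀ := θ₀) (t := t) hk hij.symm hjl hil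
  exact eq_triplePt hk hij hil hjl h1.symm (h1.symm.trans h2)

theorem triplePt_rotate (hk : Function.Injective k) {i j l : Fin N} (hij : i ≠ j) (hil : l ≠ i)
    (hjl : l ≠ j) : triplePt k θ₀ t i l j = triplePt k θ₀ t i j l := by
  obtain ⟨h1, h2⟩ := phaseAt_triplePt (θ₀ := θ₀) (t := t) hk hil.symm hij.symm hjl.symm
  exact eq_triplePt hk hij hil hjl h2 h1

/-- The slope is positive for `l` outside the interval from `i` to `j` and negative inside. With
growing `y`, outer phases rise through the common value and inner ones sink through it; all the
counting rests on this. -/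
theorem phaseAt_lt_linePt_iff (hk : StrictMono k) {i j l : Fin N} (hij : i < j) (hil : l ≠ i)
    (hjl : l ≠ j) (y : ℝ) :
    phaseAt k θ₀ t (linePt k θ₀ t i j y) i < phaseAt k θ₀ t (linePt k θ₀ t i j y) l ↔
      if l < i ∨ j < l then tripleY k θ₀ t i j l < y else y < tripleY k θ₀ t i j l := by
  rw [← sub_pos, phaseAt_linePt_sub hk.injective hij.ne hil hjl]
  split_ifs with h
  · have hpos : 0 < (k l - k i) * (k l - k j) := by
      rcases h with h | h
      · exact mul_pos_of_neg_of_neg (sub_neg.2 (hk h)) (sub_neg.2 (hk (h.trans hij)))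
      · exact mul_pos (sub_pos.2 (hk (hij.trans h))) (sub_pos.2 (hk h))
    rw [mul_pos_iff_of_pos_left hpos, sub_pos]
  · push Not at h
    have hneg : (k l - k i) * (k l - k j) < 0 :=
      mul_neg_of_pos_of_neg (sub_pos.2 (hk (lt_of_le_of_ne h.1 hil.symm)))
        (sub_neg.2 (hk (lt_of_le_of_ne h.2 hjl)))
    rw [← neg_mul_neg, mul_pos_iff_of_pos_left (neg_pos.2 hneg), neg_sub, sub_pos]

theorem linePt_phaseAt_lt_iff (hk : StrictMono k) {i j l : Fin N} (hij : i < j) (hil : l ≠ i)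
    (hjl : l ≠ j) (y : ℝ) :
    phaseAt k θ₀ t (linePt k θ₀ t i j y) l < phaseAt k θ₀ t (linePt k θ₀ t i j y) i ↔
      if l < i ∨ j < l then y < tripleY k θ₀ t i j l else tripleY k θ₀ t i j l < y := by
  have h1 := phaseAt_lt_linePt_iff (θ₀ := θ₀) (t := t) hk hij hil hjl y
  have h2 : phaseAt k θ₀ t (linePt k θ₀ t i j y) l = phaseAt k θ₀ t (linePt k θ₀ t i j y) i ↔
      y = tripleY k θ₀ t i j l := by
    rw [← sub_eq_zero, phaseAt_linePt_sub hk.injective hij.ne hil hjl, mul_eq_zero, mul_eq_zero,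
      sub_eq_zero, sub_eq_zero, sub_eq_zero, hk.injective.eq_iff, hk.injective.eq_iff]
    simp [hil, hjl]
  rw [lt_iff_le_and_ne, ← not_lt, h1, Ne, h2]
  split_ifs
  · rw [not_lt, ← lt_iff_le_and_ne]
  · rw [not_lt, ← Ne, ne_comm, ← lt_iff_le_and_ne]

theorem continuous_phaseAt (i : Fin N) : Continuous fun p => phaseAt k θ₀ t p i := by
  unfold phaseAt phase
  fun_prop

theorem continuous_linePt (i j : Fin N) : Continuous (linePt k θ₀ t i j) := by
  unfold linePt
  fun_prop

theorem isLine_phaseAt_eq (hk : Function.Injective k) {i j : Fin N} (hij : i ≠ j) :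
    IsLine {p | phaseAt k θ₀ t p i = phaseAt k θ₀ t p j} := by
  refine ⟨k j - k i, -(k j ^ 2 - k i ^ 2), (θ₀ j - k j ^ 3 * t) - (θ₀ i - k i ^ 3 * t),
    Or.inl (sub_ne_zero.2 fun h => hij (hk h.symm)), ?_⟩
  ext p
  simp only [Set.mem_ofPred_eq, phaseAt, phase]
  constructor <;> intro h <;> linear_combination h

theorem card_le_three_of_isGeneric (h : IsGeneric k θ₀ t) (p : ℝ × ℝ) (v : ℝ) :
    (Finset.univ.filter fun m => phaseAt k θ₀ t p m = v).card ≤ 3 := by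
  by_contra hcon
  obtain ⟨S, hS, hcard⟩ := Finset.exists_subset_card_eq (n := 4) (not_le.1 hcon)
  set e := S.orderEmbOfFin hcard
  have he : ∀ a, phaseAt k θ₀ t p (e a) = v := fun a =>
    (Finset.mem_filter.1 (hS (S.orderEmbOfFin_mem hcard a))).2
  refine h (e 0) (e 1) (e 2) (e 3) (e.strictMono (by decide)) (e.strictMono (by decide))
    (e.strictMono (by decide)) p.1 p.2 ⟨?_, ?_, ?_⟩
  · exact (he 0).trans (he 1).symm
  · exact (he 1).trans (he 2).symm
  · exact (he 2).trans (he 3).symm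

theorem tripleY_ne_of_isGeneric (hk : Function.Injective k) (h : IsGeneric k θ₀ t)
    {i j l m : Fin N} (hij : i ≠ j) (hil : l ≠ i) (hjl : l ≠ j) (him : m ≠ i) (hjm : m ≠ j)
    (hlm : l ≠ m) : tripleY k θ₀ t i j l ≠ tripleY k θ₀ t i j m := by
  intro heq
  have h1 := phaseAt_triplePt (θ₀ := θ₀) (t := t) hk hij hil hjl
  have h2 := phaseAt_triplePt (θ₀ := θ₀) (t := t) hk hij him hjm
  rw [triplePt, ← heq, ← triplePt] at h2
  have h3 := card_le_three_of_isGeneric h (triplePt k θ₀ t i j l)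
    (phaseAt k θ₀ t (triplePt k θ₀ t i j l) i)
  have h4 : ({i, j, l, m} : Finset (Fin N)) ⊆ Finset.univ.filter fun m =>
      phaseAt k θ₀ t (triplePt k θ₀ t i j l) m = phaseAt k θ₀ t (triplePt k θ₀ t i j l) i := by
    intro a ha
    simp only [Finset.mem_insert, Finset.mem_singleton] at ha
    refine Finset.mem_filter.2 ⟨Finset.mem_univ _, ?_⟩
    rcases ha with rfl | rfl | rfl | rfl
    · rfl
    · exact h1.1.symm
    · exact h1.2.symm
    · exact h2.2.symm
  have h5 : ({i, j, l, m} : Finset (Fin N)).card = 4 := by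
    rw [Finset.card_insert_of_notMem, Finset.card_insert_of_notMem, Finset.card_insert_of_notMem,
      Finset.card_singleton]
    · simpa using hlm
    · simp [hjl.symm, hjm.symm]
    · simp [hij, hil.symm, him.symm]
  have := Finset.card_le_card h4
  omega

/-- Four phases coincide iff two triple points on one line do. This makes genericity a finite list
of inequations between functions affine in `θ₀` and in `t`. -/
theorem isGeneric_iff (hk : Function.Injective k) :
    IsGeneric k θ₀ t ↔ ∀ i j l m : Fin N, i < j → j < l → l < m →
      tripleY k θ₀ t i j l ≠ tripleY k θ₀ t i j m := by
  constructor
  · intro h i j l m hij hjl hlm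
    exact tripleY_ne_of_isGeneric hk h hij.ne (hij.trans hjl).ne' hjl.ne'
      (hij.trans (hjl.trans hlm)).ne' (hjl.trans hlm).ne' hlm.ne
  · intro h i j l m hij hjl hlm x y ⟨h1, h2, h3⟩
    refine h i j l m hij hjl hlm ?_
    have e1 := eq_triplePt (θ₀ := θ₀) (t := t) (p := (x, y)) hk hij.ne (hij.trans hjl).ne' hjl.ne'
      h1 (h1.trans h2)
    have e2 := eq_triplePt (θ₀ := θ₀) (t := t) (p := (x, y)) hk hij.ne
      (hij.trans (hjl.trans hlm)).ne' (hjl.trans hlm).ne' h1 (h1.trans (h2.trans h3))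
    exact congrArg Prod.snd (e1.symm.trans e2)

end Geometry

/-! ### Local structure: edges as cells, vertices as triple points -/

section Cells

variable {N M : ℕ} {k θ₀ : Fin N → ℝ} {t : ℝ}

theorem mem_above {p : ℝ × ℝ} {i m : Fin N} :
    m ∈ above k θ₀ t p i ↔ phaseAt k θ₀ t p i < phaseAt k θ₀ t p m := by
  simp [above]

theorem above_congr {p : ℝ × ℝ} {i j : Fin N} (h : phaseAt k θ₀ t p i = phaseAt k θ₀ t p j) :
    above k θ₀ t p i = above k θ₀ t p j := by
  simp [above, h]

theorem mem_graph_of_tied_pair (hk : Function.Injective k) (hM : M ≤ N) {p : ℝ × ℝ} {i j : Fin N}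
    (hij : i ≠ j) (h : phaseAt k θ₀ t p i = phaseAt k θ₀ t p j)
    (hc : (above k θ₀ t p i).card + 1 = M) : p ∈ graph k M θ₀ t := by
  refine (mem_graph_iff hk hM θ₀ t p).2 ⟨i, j, hij, h, ?_, ?_⟩
  · exact lt_of_lt_of_le (Nat.lt_succ_self _) hc.le
  · have hj : j ∉ above k θ₀ t p i := fun hj => (mem_above.1 hj).ne h
    have hi : i ∉ insert j (above k θ₀ t p i) := by
      simp [hij, mem_above]
    have hsub : insert i (insert j (above k θ₀ t p i)) ⊆
        Finset.univ.filter fun m => phaseAt k θ₀ t p i ≤ phaseAt k θ₀ t p m := by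
      intro m hm
      simp only [Finset.mem_insert, mem_above] at hm
      refine Finset.mem_filter.2 ⟨Finset.mem_univ _, ?_⟩
      rcases hm with rfl | rfl | hm
      exacts [le_rfl, h.le, hm.le]
    have hle := Finset.card_le_card hsub
    rw [Finset.card_insert_of_notMem hi, Finset.card_insert_of_notMem hj] at hle
    exact lt_of_lt_of_le (by omega) hle

/-- The part of the line `θ_i = θ_j` above which exactly the phases in `A` lie and which avoids
the other phases. -/
def cell (k θ₀ : Fin N → ℝ) (t : ℝ) (A : Finset (Fin N)) (i j : Fin N) : Set (ℝ × ℝ) :=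
  {p | phaseAt k θ₀ t p i = phaseAt k θ₀ t p j ∧
    (∀ m ∈ A, phaseAt k θ₀ t p i < phaseAt k θ₀ t p m) ∧
    ∀ m ∉ A, m ≠ i → m ≠ j → phaseAt k θ₀ t p m < phaseAt k θ₀ t p i}

theorem above_of_mem_cell {A : Finset (Fin N)} {i j : Fin N} {p : ℝ × ℝ}
    (hp : p ∈ cell k θ₀ t A i j) : above k θ₀ t p i = A := by
  ext m
  rw [mem_above]
  refine ⟨fun h => ?_, hp.2.1 m⟩
  by_contra hm
  refine lt_asymm h (hp.2.2 m hm ?_ ?_)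
  · rintro rfl; exact lt_irrefl _ h
  · rintro rfl; exact h.ne hp.1

theorem cell_subset_graph (hk : Function.Injective k) (hM : M ≤ N) {A : Finset (Fin N)}
    {i j : Fin N} (hij : i ≠ j) (hA : A.card + 1 = M) : cell k θ₀ t A i j ⊆ graph k M θ₀ t :=
  fun _ hp => mem_graph_of_tied_pair hk hM hij hp.1 (by rw [above_of_mem_cell hp, hA])

/-- The phases are affine, so a cell is a line cut by open half-planes. Convexity later supplies
connectedness. -/
theorem convex_cell (A : Finset (Fin N)) (i j : Fin N) : Convex ℝ (cell k θ₀ t A i j) := by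
  have haff : ∀ (m : Fin N) (p q : ℝ × ℝ) (a b : ℝ), a + b = 1 →
      phaseAt k θ₀ t (a • p + b • q) m = a * phaseAt k θ₀ t p m + b * phaseAt k θ₀ t q m := by
    intro m p q a b hab
    simp only [phaseAt, phase, Prod.fst_add, Prod.snd_add, Prod.smul_fst, Prod.smul_snd,
      smul_eq_mul]
    linear_combination (k m ^ 3 * t - θ₀ m) * hab
  have hcomb : ∀ {x x' y y' a b : ℝ}, 0 ≤ a → 0 ≤ b → a + b = 1 → x < x' → y < y' →
      a * x + b * y < a * x' + b * y' := by
    intro x x' y y' a b ha hb hab hx hy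
    rcases ha.eq_or_lt with rfl | ha
    · obtain rfl : b = 1 := by linarith
      simpa using hy
    · exact add_lt_add_of_lt_of_le (mul_lt_mul_of_pos_left hx ha)
        (mul_le_mul_of_nonneg_left hy.le hb)
  intro p hp q hq a b ha hb hab
  refine ⟨?_, fun m hm => ?_, fun m hm hi hj => ?_⟩
  · rw [haff _ _ _ _ _ hab, haff _ _ _ _ _ hab, hp.1, hq.1]
  · rw [haff _ _ _ _ _ hab, haff _ _ _ _ _ hab]
    exact hcomb ha hb hab (hp.2.1 m hm) (hq.2.1 m hm)
  · rw [haff _ _ _ _ _ hab, haff _ _ _ _ _ hab]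
    exact hcomb ha hb hab (hp.2.2 m hm hi hj) (hq.2.2 m hm hi hj)

/-- If the tied value at `i'` were larger, `A` would contain `i'` and all of `A'`, exceeding its
cardinality. -/
theorem value_le_of_mem_cell {A A' : Finset (Fin N)} {i j i' j' : Fin N} {p : ℝ × ℝ}
    (hij' : i' ≠ j') (hc : A.card = A'.card)
    (hp : p ∈ cell k θ₀ t A i j) (hp' : p ∈ cell k θ₀ t A' i' j') :
    phaseAt k θ₀ t p i' ≤ phaseAt k θ₀ t p i := by
  by_contra! hlt
  have hA := above_of_mem_cell hp
  have hsub : insert i' A' ⊆ A := by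
    intro m hm
    rw [← hA, mem_above]
    rcases Finset.mem_insert.1 hm with rfl | hm
    · exact hlt
    · exact hlt.trans (hp'.2.1 m hm)
  have hi' : i' ∉ A' := fun h => lt_irrefl _ (hp'.2.1 i' h)
  have := Finset.card_le_card hsub
  rw [Finset.card_insert_of_notMem hi'] at this
  omega

theorem cell_index_unique {A A' : Finset (Fin N)} {i j i' j' : Fin N} {p : ℝ × ℝ}
    (hij : i < j) (hij' : i' < j') (hc : A.card = A'.card)
    (hp : p ∈ cell k θ₀ t A i j) (hp' : p ∈ cell k θ₀ t A' i' j') :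
    A = A' ∧ i = i' ∧ j = j' := by
  have hv : phaseAt k θ₀ t p i = phaseAt k θ₀ t p i' :=
    le_antisymm (value_le_of_mem_cell hij.ne hc.symm hp' hp)
      (value_le_of_mem_cell hij'.ne hc hp hp')
  have hmem : ∀ m, phaseAt k θ₀ t p i = phaseAt k θ₀ t p m → m = i ∨ m = j := by
    intro m hm
    by_contra! hne
    by_cases hmA : m ∈ A
    · exact (hp.2.1 m hmA).ne hm
    · exact (hp.2.2 m hmA hne.1 hne.2).ne' hm
  refine ⟨by rw [← above_of_mem_cell hp, ← above_of_mem_cell hp', above_congr hv], ?_⟩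
  have h1 := hmem i' hv
  have h2 := hmem j' (hv.trans hp'.1)
  omega

/-- The strict inequalities of the cell persist near `p`, so only `θ_i` and `θ_j` can occupy ranks
`M` and `M + 1` there. -/
theorem eventually_mem_graph_iff (hk : Function.Injective k) (hM : M ≤ N) {A : Finset (Fin N)}
    {i j : Fin N} (hij : i ≠ j) (hA : A.card + 1 = M) {p : ℝ × ℝ} (hp : p ∈ cell k θ₀ t A i j) :
    ∀ᶠ q in 𝓝 p, (q ∈ graph k M θ₀ t ↔ phaseAt k θ₀ t q i = phaseAt k θ₀ t q j) ∧
      (phaseAt k θ₀ t q i = phaseAt k θ₀ t q j → q ∈ cell k θ₀ t A i j) := by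
  have hc : ∀ a b, phaseAt k θ₀ t p a < phaseAt k θ₀ t p b →
      ∀ᶠ q in 𝓝 p, phaseAt k θ₀ t q a < phaseAt k θ₀ t q b := fun a b hab =>
    ((continuous_phaseAt a).tendsto p).eventually_lt ((continuous_phaseAt b).tendsto p) hab
  have h1 : ∀ᶠ q in 𝓝 p, ∀ m, m ∈ A → phaseAt k θ₀ t q i < phaseAt k θ₀ t q m ∧
      phaseAt k θ₀ t q j < phaseAt k θ₀ t q m := by
    refine eventually_all.2 fun m => ?_
    by_cases hm : m ∈ A
    · filter_upwards [hc i m (hp.2.1 m hm), hc j m (hp.1 ▸ hp.2.1 m hm)] with q h1 h2 _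
      exact ⟨h1, h2⟩
    · exact Eventually.of_forall fun q h => absurd h hm
  have h2 : ∀ᶠ q in 𝓝 p, ∀ m, m ∉ A ∧ m ≠ i ∧ m ≠ j →
      phaseAt k θ₀ t q m < phaseAt k θ₀ t q i ∧ phaseAt k θ₀ t q m < phaseAt k θ₀ t q j := by
    refine eventually_all.2 fun m => ?_
    by_cases hm : m ∉ A ∧ m ≠ i ∧ m ≠ j
    · have h3 := hp.2.2 m hm.1 hm.2.1 hm.2.2
      filter_upwards [hc m i h3, hc m j (hp.1 ▸ h3)] with q h1 h2 _
      exact ⟨h1, h2⟩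
    · exact Eventually.of_forall fun q h => absurd h hm
  have hiA : i ∉ A := fun h => lt_irrefl _ (hp.2.1 i h)
  have hjA : j ∉ A := fun h => (hp.2.1 j h).ne hp.1
  filter_upwards [h1, h2] with q h1 h2
  have hcell : phaseAt k θ₀ t q i = phaseAt k θ₀ t q j → q ∈ cell k θ₀ t A i j := fun h =>
    ⟨h, fun m hm => (h1 m hm).1, fun m hm hi hj => (h2 m ⟨hm, hi, hj⟩).1⟩
  refine ⟨⟨fun hq => ?_, fun h => cell_subset_graph hk hM hij hA (hcell h)⟩, hcell⟩
  obtain ⟨a, b, hab, heq, hlt, hgt⟩ := (mem_graph_iff hk hM θ₀ t q).1 hq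
  change phaseAt k θ₀ t q a = phaseAt k θ₀ t q b at heq
  change (above k θ₀ t q a).card < M at hlt
  change M < (Finset.univ.filter fun m => phaseAt k θ₀ t q a ≤ phaseAt k θ₀ t q m).card at hgt
  -- A tied index in `A` would leave at most `M - 1` phases at or above the tied value; any other
  -- index besides `i`, `j` would have at least `M` phases strictly above it.
  have key : ∀ c, phaseAt k θ₀ t q a = phaseAt k θ₀ t q c → c = i ∨ c = j := by
    intro c hca
    by_contra! hne
    by_cases hcA : c ∈ A
    · have hsub : (Finset.univ.filter fun m => phaseAt k θ₀ t q a ≤ phaseAt k θ₀ t q m) ⊆ A := by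
        intro m hm
        have hm' := (Finset.mem_filter.1 hm).2
        rw [hca] at hm'
        by_contra hmA
        have h3 := h1 c hcA
        by_cases hmi : m = i
        · subst hmi; exact absurd h3.1 (not_lt.2 hm')
        by_cases hmj : m = j
        · subst hmj; exact absurd h3.2 (not_lt.2 hm')
        exact absurd ((h2 m ⟨hmA, hmi, hmj⟩).1.trans h3.1) (not_lt.2 hm')
      have := Finset.card_le_card hsub
      omega
    · have h3 := h2 c ⟨hcA, hne.1, hne.2⟩
      have hsub : insert i A ⊆ above k θ₀ t q a := by
        intro m hm
        rw [mem_above, hca]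
        rcases Finset.mem_insert.1 hm with rfl | hm
        · exact h3.1
        · exact h3.1.trans (h1 m hm).1
      have := Finset.card_le_card hsub
      rw [Finset.card_insert_of_notMem hiA] at this
      omega
  rcases key a rfl with rfl | rfl <;> rcases key b heq with rfl | rfl
  · exact absurd rfl hab
  · exact heq
  · exact heq.symm
  · exact absurd rfl hab

theorem notMem_vertices_of_mem_cell (hk : Function.Injective k) (hM : M ≤ N) {A : Finset (Fin N)}
    {i j : Fin N} (hij : i ≠ j) (hA : A.card + 1 = M) {p : ℝ × ℝ} (hp : p ∈ cell k θ₀ t A i j) :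
    p ∉ vertices (graph k M θ₀ t) := by
  rintro ⟨-, hv⟩
  refine hv ⟨_, isLine_phaseAt_eq (θ₀ := θ₀) (t := t) hk hij, _,
    eventually_mem_graph_iff hk hM hij hA hp, ?_⟩
  ext q
  exact ⟨fun h => ⟨h.2.1.1 h.1, h.2⟩, fun h => ⟨h.2.1.2 h.1, h.2⟩⟩

/-- Three phases tie at `p`, and the graph passes through `p`. -/
def IsTriple (k θ₀ : Fin N → ℝ) (t : ℝ) (M : ℕ) (p : ℝ × ℝ) (i j l : Fin N) : Prop :=
  phaseAt k θ₀ t p i = phaseAt k θ₀ t p j ∧ phaseAt k θ₀ t p i = phaseAt k θ₀ t p l ∧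
    ((above k θ₀ t p i).card + 1 = M ∨ (above k θ₀ t p i).card + 2 = M)

theorem eq_of_isTriple (hg : IsGeneric k θ₀ t) {p : ℝ × ℝ} {i j l m : Fin N} (hij : i ≠ j)
    (hil : l ≠ i) (hjl : l ≠ j) (h1 : phaseAt k θ₀ t p i = phaseAt k θ₀ t p j)
    (h2 : phaseAt k θ₀ t p i = phaseAt k θ₀ t p l)
    (hm : phaseAt k θ₀ t p i = phaseAt k θ₀ t p m) : m = i ∨ m = j ∨ m = l := by
  by_contra! hne
  have h3 := card_le_three_of_isGeneric hg p (phaseAt k θ₀ t p i)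
  have h4 : ({m, i, j, l} : Finset (Fin N)) ⊆ Finset.univ.filter fun m =>
      phaseAt k θ₀ t p m = phaseAt k θ₀ t p i := by
    intro a ha
    simp only [Finset.mem_insert, Finset.mem_singleton] at ha
    refine Finset.mem_filter.2 ⟨Finset.mem_univ _, ?_⟩
    rcases ha with rfl | rfl | rfl | rfl
    exacts [hm.symm, rfl, h1.symm, h2.symm]
  have h5 : ({m, i, j, l} : Finset (Fin N)).card = 4 := by
    rw [Finset.card_insert_of_notMem, Finset.card_insert_of_notMem, Finset.card_insert_of_notMem,
      Finset.card_singleton]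
    · simpa using hjl.symm
    · simp [hij, hil.symm]
    · simp [hne.1, hne.2.1, hne.2.2]
  have := Finset.card_le_card h4
  omega

theorem frequently_pos_mul_sub {σ : ℝ} (hσ : σ ≠ 0) (y₀ : ℝ) :
    ∃ᶠ y in 𝓝[≠] y₀, 0 < σ * (y - y₀) := by
  rcases lt_or_gt_of_ne hσ with h | h
  · have : ∀ᶠ y in 𝓝[<] y₀, 0 < σ * (y - y₀) := by
      filter_upwards [self_mem_nhdsWithin] with y hy
      exact mul_pos_of_neg_of_neg h (sub_neg.2 hy)
    exact this.frequently.filter_mono (nhdsWithin_mono _ fun y hy => ne_of_lt hy)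
  · have : ∀ᶠ y in 𝓝[>] y₀, 0 < σ * (y - y₀) := by
      filter_upwards [self_mem_nhdsWithin] with y hy
      exact mul_pos h (sub_pos.2 hy)
    exact this.frequently.filter_mono (nhdsWithin_mono _ fun y hy => ne_of_gt hy)

/-- Near `p` on the line `θ_i = θ_j`, only `θ_l` changes its position relative to `θ_i`: it lies
below on one side of `p` and above on the other. In either case of `IsTriple`, one side has exactly
`M - 1` phases above and belongs to the graph. -/
theorem frequently_linePt_mem_graph (hk : Function.Injective k) (hM : M ≤ N)
    (hg : IsGeneric k θ₀ t) {p : ℝ × ℝ} {i j l : Fin N} (hij : i ≠ j) (hil : l ≠ i) (hjl : l ≠ j)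
    (h : IsTriple k θ₀ t M p i j l) :
    ∃ᶠ y in 𝓝[≠] p.2, linePt k θ₀ t i j y ∈ graph k M θ₀ t := by
  obtain ⟨h1, h2, hc⟩ := h
  have hp : p = linePt k θ₀ t i j p.2 := (phaseAt_eq_iff hk hij p).1 h1
  have hY : tripleY k θ₀ t i j l = p.2 :=
    (congrArg Prod.snd (eq_triplePt hk hij hil hjl h1 h2)).symm
  have hκ : (k l - k i) * (k l - k j) ≠ 0 :=
    mul_ne_zero (sub_ne_zero.2 fun h => hil (hk h)) (sub_ne_zero.2 fun h => hjl (hk h))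
  have hcont : ∀ a b, phaseAt k θ₀ t p a < phaseAt k θ₀ t p b → ∀ᶠ y in 𝓝 p.2,
      phaseAt k θ₀ t (linePt k θ₀ t i j y) a < phaseAt k θ₀ t (linePt k θ₀ t i j y) b := by
    intro a b hab
    refine (((continuous_phaseAt a).comp (continuous_linePt i j)).tendsto p.2).eventually_lt
      (((continuous_phaseAt b).comp (continuous_linePt i j)).tendsto p.2) ?_
    simpa [← hp] using hab
  have hstable : ∀ᶠ y in 𝓝[≠] p.2, ∀ m, m ≠ l →
      (m ∈ above k θ₀ t (linePt k θ₀ t i j y) i ↔ m ∈ above k θ₀ t p i) := by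
    refine (eventually_all.2 fun m => ?_).filter_mono nhdsWithin_le_nhds
    simp only [mem_above]
    by_cases hml : m = l
    · exact Eventually.of_forall fun y h => absurd hml h
    rcases lt_trichotomy (phaseAt k θ₀ t p i) (phaseAt k θ₀ t p m) with hlt | heq | hgt
    · filter_upwards [hcont i m hlt] with y hy _
      exact iff_of_true hy hlt
    · rcases eq_of_isTriple hg hij hil hjl h1 h2 heq with rfl | rfl | rfl
      · exact Eventually.of_forall fun y _ => by simp
      · exact Eventually.of_forall fun y _ => by simp [h1, phaseAt_linePt hk hij]
      · exact absurd rfl hml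
    · filter_upwards [hcont m i hgt] with y hy _
      exact iff_of_false (lt_asymm hy) (lt_asymm hgt)
  have hl : ∀ y, l ∈ above k θ₀ t (linePt k θ₀ t i j y) i ↔
      0 < (k l - k i) * (k l - k j) * (y - p.2) := fun y => by
    rw [mem_above, ← sub_pos, phaseAt_linePt_sub hk hij hil hjl, hY]
  have hlp : l ∉ above k θ₀ t p i := fun h => (mem_above.1 h).ne h2
  rcases hc with hc | hc
  · refine ((frequently_pos_mul_sub (neg_ne_zero.2 hκ) p.2).and_eventually hstable).mono ?_
    rintro y ⟨hy, hst⟩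
    have hly : l ∉ above k θ₀ t (linePt k θ₀ t i j y) i := by
      rw [hl, not_lt]; linarith
    have hab : above k θ₀ t (linePt k θ₀ t i j y) i = above k θ₀ t p i := by
      ext m
      by_cases hml : m = l
      · subst hml; exact iff_of_false hly hlp
      · exact hst m hml
    exact mem_graph_of_tied_pair hk hM hij (phaseAt_linePt hk hij y) (by rw [hab, hc])
  · refine ((frequently_pos_mul_sub hκ p.2).and_eventually hstable).mono ?_
    rintro y ⟨hy, hst⟩
    have hab : above k θ₀ t (linePt k θ₀ t i j y) i = insert l (above k θ₀ t p i) := by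
      ext m
      by_cases hml : m = l
      · subst hml; exact iff_of_true ((hl y).2 hy) (Finset.mem_insert_self _ _)
      · rw [hst m hml, Finset.mem_insert, or_iff_right hml]
    exact mem_graph_of_tied_pair hk hM hij (phaseAt_linePt hk hij y)
      (by rw [hab, Finset.card_insert_of_notMem hlp, ← hc])

theorem direction_of_graph_eq_line (hk : Function.Injective k) (hM : M ≤ N)
    (hg : IsGeneric k θ₀ t) {p : ℝ × ℝ} {i j l : Fin N} (hij : i ≠ j) (hil : l ≠ i) (hjl : l ≠ j)
    (h : IsTriple k θ₀ t M p i j l) {a b c : ℝ} {U : Set (ℝ × ℝ)} (hU : U ∈ 𝓝 p)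
    (hp : p ∈ graph k M θ₀ t) (hGU : graph k M θ₀ t ∩ U = {q | a * q.1 + b * q.2 = c} ∩ U) :
    a * (k i + k j) + b = 0 := by
  have hp' : p = linePt k θ₀ t i j p.2 := (phaseAt_eq_iff hk hij p).1 h.1
  have hUy : ∀ᶠ y in 𝓝 p.2, linePt k θ₀ t i j y ∈ U :=
    (continuous_linePt i j).continuousAt.eventually_mem (by rwa [← hp'])
  obtain ⟨y, hy, hyU, hne⟩ := ((frequently_linePt_mem_graph hk hM hg hij hil hjl h).and_eventually
    ((hUy.filter_mono nhdsWithin_le_nhds).and self_mem_nhdsWithin)).exists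
  have e1 : linePt k θ₀ t i j y ∈ {q : ℝ × ℝ | a * q.1 + b * q.2 = c} ∩ U :=
    hGU ▸ ⟨hy, hyU⟩
  have e2 : p ∈ {q : ℝ × ℝ | a * q.1 + b * q.2 = c} ∩ U := hGU ▸ ⟨hp, mem_of_mem_nhds hU⟩
  have e1' := e1.1
  have e2' := e2.1
  rw [hp'] at e2'
  simp only [Set.mem_ofPred_eq, linePt] at e1' e2'
  have hne' : y - p.2 ≠ 0 := sub_ne_zero.2 hne
  refine (mul_eq_zero.1 (?_ : (y - p.2) * (a * (k i + k j) + b) = 0)).resolve_left hne'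
  linear_combination e1' - e2'

theorem mem_graph_of_isTriple (hk : Function.Injective k) (hM : M ≤ N) {p : ℝ × ℝ}
    {i j l : Fin N} (hij : i ≠ j) (hil : l ≠ i) (hjl : l ≠ j) (h : IsTriple k θ₀ t M p i j l) :
    p ∈ graph k M θ₀ t := by
  obtain ⟨h1, h2, hc⟩ := h
  refine (mem_graph_iff hk hM θ₀ t p).2 ⟨i, j, hij, h1, ?_, ?_⟩
  · change (above k θ₀ t p i).card < M
    omega
  · change M < (Finset.univ.filter fun m => phaseAt k θ₀ t p i ≤ phaseAt k θ₀ t p m).card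
    have hj : j ∉ above k θ₀ t p i := fun hj => (mem_above.1 hj).ne h1
    have hl : l ∉ above k θ₀ t p i := fun hl => (mem_above.1 hl).ne h2
    have hj' : j ∉ insert l (above k θ₀ t p i) := by simp [hj, hjl.symm]
    have hi : i ∉ insert j (insert l (above k θ₀ t p i)) := by simp [hij, hil.symm, mem_above]
    have hsub : insert i (insert j (insert l (above k θ₀ t p i))) ⊆
        Finset.univ.filter fun m => phaseAt k θ₀ t p i ≤ phaseAt k θ₀ t p m := by
      intro m hm
      simp only [Finset.mem_insert, mem_above] at hm
      refine Finset.mem_filter.2 ⟨Finset.mem_univ _, ?_⟩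
      rcases hm with rfl | rfl | rfl | hm
      exacts [le_rfl, h1.le, h2.le, hm.le]
    have hle := Finset.card_le_card hsub
    rw [Finset.card_insert_of_notMem hi, Finset.card_insert_of_notMem hj',
      Finset.card_insert_of_notMem hl] at hle
    omega

/-- A single line through `p` would need both directions `(k i + k j, 1)` and `(k i + k l, 1)`,
which differ. -/
theorem mem_vertices_of_isTriple (hk : Function.Injective k) (hM : M ≤ N)
    (hg : IsGeneric k θ₀ t) {p : ℝ × ℝ} {i j l : Fin N} (hij : i ≠ j) (hil : l ≠ i) (hjl : l ≠ j)
    (h : IsTriple k θ₀ t M p i j l) : p ∈ vertices (graph k M θ₀ t) := by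
  have hp := mem_graph_of_isTriple hk hM hij hil hjl h
  refine ⟨hp, ?_⟩
  rintro ⟨L, ⟨a, b, c, hab, rfl⟩, U, hU, hGU⟩
  have e1 := direction_of_graph_eq_line hk hM hg hij hil hjl h hU hp hGU
  have e2 := direction_of_graph_eq_line hk hM hg hil.symm hij.symm hjl.symm
    ⟨h.2.1, h.1, h.2.2⟩ hU hp hGU
  have h3 : a * (k j - k l) = 0 := by linear_combination e1 - e2
  have ha : a = 0 :=
    (mul_eq_zero.1 h3).resolve_right (sub_ne_zero.2 fun h => hjl (hk h.symm))
  rcases hab with hab | hab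
  · exact hab ha
  · refine hab ?_
    rw [ha] at e1
    linarith

/-- The tie fills ranks `M` and `M + 1`, and genericity limits it to three phases. Two tied phases
force `M - 1` phases above; three allow `M - 1` or `M - 2`. -/
theorem mem_cell_or_isTriple (hk : Function.Injective k) (hM : M ≤ N) (hg : IsGeneric k θ₀ t)
    {p : ℝ × ℝ} (hp : p ∈ graph k M θ₀ t) :
    (∃ A i j, i < j ∧ A.card + 1 = M ∧ p ∈ cell k θ₀ t A i j) ∨
      ∃ i j l, i < j ∧ j < l ∧ IsTriple k θ₀ t M p i j l := by
  obtain ⟨i, j, hij, heq, hlt, hgt⟩ : ∃ i j, i < j ∧ phaseAt k θ₀ t p i = phaseAt k θ₀ t p j ∧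
      (above k θ₀ t p i).card < M ∧
      M < (Finset.univ.filter fun m => phaseAt k θ₀ t p i ≤ phaseAt k θ₀ t p m).card := by
    obtain ⟨i, j, hij, heq, hlt, hgt⟩ := (mem_graph_iff hk hM θ₀ t p).1 hp
    rcases lt_or_gt_of_ne hij with h | h
    · exact ⟨i, j, h, heq, hlt, hgt⟩
    · rw [heq] at hlt hgt
      exact ⟨j, i, h, heq.symm, hlt, hgt⟩
  by_cases hl : ∃ l, l ≠ i ∧ l ≠ j ∧ phaseAt k θ₀ t p i = phaseAt k θ₀ t p l
  · right
    obtain ⟨l, hli, hlj, hil⟩ := hl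
    have hsub : (Finset.univ.filter fun m => phaseAt k θ₀ t p i ≤ phaseAt k θ₀ t p m) ⊆
        above k θ₀ t p i ∪ {i, j, l} := by
      intro m hm
      simp only [Finset.mem_union, mem_above, Finset.mem_insert, Finset.mem_singleton]
      rcases (Finset.mem_filter.1 hm).2.lt_or_eq with h | h
      · exact Or.inl h
      · exact Or.inr (eq_of_isTriple hg hij.ne hli hlj heq hil h)
    have h1 := (Finset.card_le_card hsub).trans (Finset.card_union_le _ _)
    have h2 : ({i, j, l} : Finset (Fin N)).card ≤ 3 := Finset.card_le_three
    have hc : (above k θ₀ t p i).card + 1 = M ∨ (above k θ₀ t p i).card + 2 = M := by omega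
    rcases lt_or_gt_of_ne hli with h | h
    · exact ⟨l, i, j, h, hij, hil.symm, hil.symm.trans heq, by rwa [← above_congr hil]⟩
    rcases lt_or_gt_of_ne hlj with h' | h'
    · exact ⟨i, l, j, h, h', hil, heq, hc⟩
    · exact ⟨i, j, l, hij, h', heq, hil, hc⟩
  · left
    push Not at hl
    have hsub : (Finset.univ.filter fun m => phaseAt k θ₀ t p i ≤ phaseAt k θ₀ t p m) ⊆
        above k θ₀ t p i ∪ {i, j} := by
      intro m hm
      simp only [Finset.mem_union, mem_above, Finset.mem_insert, Finset.mem_singleton]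
      rcases (Finset.mem_filter.1 hm).2.lt_or_eq with h | h
      · exact Or.inl h
      · by_contra! hne
        exact hl m hne.2.1 hne.2.2 h
    have h1 := (Finset.card_le_card hsub).trans (Finset.card_union_le _ _)
    have h2 : ({i, j} : Finset (Fin N)).card ≤ 2 := Finset.card_le_two
    refine ⟨above k θ₀ t p i, i, j, hij, by omega, heq, fun m hm => mem_above.1 hm,
      fun m hm hi hj => lt_of_le_of_ne (not_lt.1 fun h => hm (mem_above.2 h))
        (hl m hi hj).symm⟩

theorem mem_vertices_iff (hk : Function.Injective k) (hM : M ≤ N) (hg : IsGeneric k θ₀ t)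
    (p : ℝ × ℝ) : p ∈ vertices (graph k M θ₀ t) ↔
      ∃ i j l, i < j ∧ j < l ∧ IsTriple k θ₀ t M p i j l := by
  constructor
  · intro hp
    refine (mem_cell_or_isTriple hk hM hg hp.1).resolve_left ?_
    rintro ⟨A, i, j, hij, hA, hpc⟩
    exact notMem_vertices_of_mem_cell hk hM hij.ne hA hpc hp
  · rintro ⟨i, j, l, hij, hjl, h⟩
    exact mem_vertices_of_isTriple hk hM hg hij.ne (hij.trans hjl).ne' hjl.ne' h

theorem mem_graph_diff_vertices_iff (hk : Function.Injective k) (hM : M ≤ N)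
    (hg : IsGeneric k θ₀ t) (p : ℝ × ℝ) :
    p ∈ graph k M θ₀ t \ vertices (graph k M θ₀ t) ↔
      ∃ A i j, i < j ∧ A.card + 1 = M ∧ p ∈ cell k θ₀ t A i j := by
  constructor
  · rintro ⟨hp, hv⟩
    exact (mem_cell_or_isTriple hk hM hg hp).resolve_right
      fun h => hv ((mem_vertices_iff hk hM hg p).2 h)
  · rintro ⟨A, i, j, hij, hA, hp⟩
    exact ⟨cell_subset_graph hk hM hij.ne hA hp, notMem_vertices_of_mem_cell hk hM hij.ne hA hp⟩

/-- The cell is connected, and membership in it is locally constant on the graph without vertices,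
since near each point that set is a single cell and distinct cells are disjoint. -/
theorem connectedComponentIn_eq_cell (hk : Function.Injective k) (hM : M ≤ N)
    (hg : IsGeneric k θ₀ t) {A : Finset (Fin N)} {i j : Fin N} (hij : i < j)
    (hA : A.card + 1 = M) {p : ℝ × ℝ} (hp : p ∈ cell k θ₀ t A i j) :
    connectedComponentIn (graph k M θ₀ t \ vertices (graph k M θ₀ t)) p = cell k θ₀ t A i j := by
  classical
  set X := graph k M θ₀ t \ vertices (graph k M θ₀ t) with hX
  have hsub : cell k θ₀ t A i j ⊆ X := fun q hq =>
    (mem_graph_diff_vertices_iff hk hM hg q).2 ⟨A, i, j, hij, hA, hq⟩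
  refine Set.Subset.antisymm (fun q hq => ?_)
    ((convex_cell A i j).isPreconnected.subset_connectedComponentIn hp hsub)
  have hcont : ContinuousOn (fun q => decide (q ∈ cell k θ₀ t A i j))
      (connectedComponentIn X p) := by
    intro r hr
    have hrX := connectedComponentIn_subset X p hr
    obtain ⟨A', i', j', hij', hA', hr'⟩ := (mem_graph_diff_vertices_iff hk hM hg r).1 hrX
    have hev : ∀ᶠ r' in 𝓝[connectedComponentIn X p] r,
        decide (r ∈ cell k θ₀ t A i j) = decide (r' ∈ cell k θ₀ t A i j) := by
      filter_upwards [(eventually_mem_graph_iff hk hM hij'.ne hA' hr').filter_mono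
        nhdsWithin_le_nhds, self_mem_nhdsWithin] with r' h1 h2
      have hr'' := h1.2 (h1.1.1 (connectedComponentIn_subset X p h2).1)
      rw [decide_eq_decide]
      constructor <;> intro h
      · obtain ⟨rfl, rfl, rfl⟩ := cell_index_unique hij hij' (by omega) h hr'
        exact hr''
      · obtain ⟨rfl, rfl, rfl⟩ := cell_index_unique hij hij' (by omega) h hr''
        exact hr'
    exact tendsto_const_nhds.congr' hev
  have := isPreconnected_connectedComponentIn.constant hcont hq
    (mem_connectedComponentIn (hsub hp))
  simpa [hp] using this

theorem mem_edges_iff (hk : Function.Injective k) (hM : M ≤ N) (hg : IsGeneric k θ₀ t)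
    (e : Set (ℝ × ℝ)) : e ∈ edges (graph k M θ₀ t) ↔
      ∃ A i j, i < j ∧ A.card + 1 = M ∧ (cell k θ₀ t A i j).Nonempty ∧
        e = cell k θ₀ t A i j := by
  constructor
  · rintro ⟨p, hp, rfl⟩
    obtain ⟨A, i, j, hij, hA, hpc⟩ := (mem_graph_diff_vertices_iff hk hM hg p).1 hp
    exact ⟨A, i, j, hij, hA, ⟨p, hpc⟩, connectedComponentIn_eq_cell hk hM hg hij hA hpc⟩
  · rintro ⟨A, i, j, hij, hA, ⟨p, hp⟩, rfl⟩
    exact ⟨p, (mem_graph_diff_vertices_iff hk hM hg p).2 ⟨A, i, j, hij, hA, hp⟩,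
      (connectedComponentIn_eq_cell hk hM hg hij hA hp).symm⟩

end Cells

/-! ### Finite index sets for vertices and bounded edges -/

section Indexing

variable {N M : ℕ} {k θ₀ : Fin N → ℝ} {t : ℝ}

/-- The number of phases above the triple point of `i`, `j`, `l`. -/
noncomputable def level (k θ₀ : Fin N → ℝ) (t : ℝ) (i j l : Fin N) : ℕ :=
  (above k θ₀ t (triplePt k θ₀ t i j l) i).card

/-- The level is symmetric in the three indices, so it can be read off on any of the three lines
through the triple point. -/
theorem level_swap (hk : Function.Injective k) {i j l : Fin N} (hij : i ≠ j) (hil : l ≠ i)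
    (hjl : l ≠ j) : level k θ₀ t j i l = level k θ₀ t i j l := by
  rw [level, level, triplePt_swap hk hij hil hjl,
    above_congr (phaseAt_triplePt hk hij hil hjl).1]

theorem level_rotate (hk : Function.Injective k) {i j l : Fin N} (hij : i ≠ j) (hil : l ≠ i)
    (hjl : l ≠ j) : level k θ₀ t i l j = level k θ₀ t i j l := by
  rw [level, level, triplePt_rotate hk hij hil hjl]

open Classical in
/-- The triples of phases that meet in a vertex of the graph. -/
noncomputable def vertexIndices (k θ₀ : Fin N → ℝ) (t : ℝ) (M : ℕ) :
    Finset (Fin N × Fin N × Fin N) :=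
  Finset.univ.filter fun x => x.1 < x.2.1 ∧ x.2.1 < x.2.2 ∧
    (level k θ₀ t x.1 x.2.1 x.2.2 + 1 = M ∨ level k θ₀ t x.1 x.2.1 x.2.2 + 2 = M)

theorem vertices_eq_image (hk : Function.Injective k) (hM : M ≤ N) (hg : IsGeneric k θ₀ t) :
    vertices (graph k M θ₀ t) =
      (fun x : Fin N × Fin N × Fin N => triplePt k θ₀ t x.1 x.2.1 x.2.2) ''
        (vertexIndices k θ₀ t M : Set (Fin N × Fin N × Fin N)) := by
  ext p
  rw [mem_vertices_iff hk hM hg]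
  constructor
  · rintro ⟨i, j, l, hij, hjl, h1, h2, hc⟩
    obtain rfl := eq_triplePt hk hij.ne (hij.trans hjl).ne' hjl.ne' h1 h2
    exact ⟨(i, j, l), by simpa [vertexIndices] using ⟨hij, hjl, hc⟩, rfl⟩
  · rintro ⟨⟨i, j, l⟩, hx, rfl⟩
    simp only [vertexIndices, Finset.coe_filter, Finset.mem_univ, true_and,
      Set.mem_ofPred_eq] at hx
    obtain ⟨h1, h2⟩ := phaseAt_triplePt (θ₀ := θ₀) (t := t) hk hx.1.ne (hx.1.trans hx.2.1).ne'
      hx.2.1.ne'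
    exact ⟨i, j, l, hx.1, hx.2.1, h1, h2, hx.2.2⟩

/-- A higher tied triple and everything above it would put at least `M + 1` phases above `θ_i`, but
there are at most `M - 1`. -/
theorem IsTriple.value_le {p : ℝ × ℝ} {i j l i' j' l' : Fin N} (hij' : i' < j') (hjl' : j' < l')
    (h : IsTriple k θ₀ t M p i j l) (h' : IsTriple k θ₀ t M p i' j' l') :
    phaseAt k θ₀ t p i' ≤ phaseAt k θ₀ t p i := by
  by_contra! hlt
  obtain ⟨-, -, hc⟩ := h
  obtain ⟨h1', h2', hc'⟩ := h'
  have hl : l' ∉ above k θ₀ t p i' := fun h => (mem_above.1 h).ne h2'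
  have hj : j' ∉ insert l' (above k θ₀ t p i') := by
    simp [hjl'.ne, mem_above, h1']
  have hsub : insert j' (insert l' (above k θ₀ t p i')) ⊆ above k θ₀ t p i := by
    intro m hm
    simp only [Finset.mem_insert, mem_above] at hm ⊢
    rcases hm with rfl | rfl | hm
    exacts [h1' ▸ hlt, h2' ▸ hlt, hlt.trans hm]
  have hi : i' ∉ insert j' (insert l' (above k θ₀ t p i')) := by
    simp [hij'.ne, (hij'.trans hjl').ne, mem_above]
  have hsub' : insert i' (insert j' (insert l' (above k θ₀ t p i'))) ⊆ above k θ₀ t p i :=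
    Finset.insert_subset (mem_above.2 hlt) hsub
  have := Finset.card_le_card hsub'
  rw [Finset.card_insert_of_notMem hi, Finset.card_insert_of_notMem hj,
    Finset.card_insert_of_notMem hl] at this
  omega

theorem injOn_triplePt (hk : Function.Injective k) (hg : IsGeneric k θ₀ t) :
    Set.InjOn (fun x : Fin N × Fin N × Fin N => triplePt k θ₀ t x.1 x.2.1 x.2.2)
      (vertexIndices k θ₀ t M : Set (Fin N × Fin N × Fin N)) := by
  rintro ⟨i, j, l⟩ hx ⟨i', j', l'⟩ hx' heq
  simp only [Finset.mem_coe, vertexIndices, Finset.mem_filter, Finset.mem_univ, true_and] at hx hx'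
  simp only [level] at hx hx' heq
  obtain ⟨hij, hjl, hc⟩ := hx
  obtain ⟨hij', hjl', hc'⟩ := hx'
  obtain ⟨h1, h2⟩ := phaseAt_triplePt (θ₀ := θ₀) (t := t) hk hij.ne (hij.trans hjl).ne' hjl.ne'
  obtain ⟨h1', h2'⟩ := phaseAt_triplePt (θ₀ := θ₀) (t := t) hk hij'.ne (hij'.trans hjl').ne'
    hjl'.ne'
  rw [← heq] at h1' h2' hc'
  have hT : IsTriple k θ₀ t M _ i j l := ⟨h1, h2, hc⟩
  have hT' : IsTriple k θ₀ t M _ i' j' l' := ⟨h1', h2', hc'⟩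
  have hv := le_antisymm (hT'.value_le hij hjl hT) (hT.value_le hij' hjl' hT')
  have e := fun m => eq_of_isTriple (m := m) hg hij.ne (hij.trans hjl).ne' hjl.ne' h1 h2
  have e1 := e i' hv
  have e2 := e j' (hv.trans h1')
  have e3 := e l' (hv.trans h2')
  simp only [Prod.mk.injEq]
  omega

theorem ncard_vertices (hk : Function.Injective k) (hM : M ≤ N) (hg : IsGeneric k θ₀ t) :
    (vertices (graph k M θ₀ t)).Finite ∧
      (vertices (graph k M θ₀ t)).ncard = (vertexIndices k θ₀ t M).card := by
  rw [vertices_eq_image hk hM hg, (injOn_triplePt hk hg).ncard_image,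
    Set.ncard_coe_finset]
  exact ⟨(Finset.finite_toSet _).image _, rfl⟩

/-- The phases above the line `θ_i = θ_j` just below (in the ordinate `y`) its triple point
with `r`. -/
noncomputable def aboveBefore (k θ₀ : Fin N → ℝ) (t : ℝ) (i j r : Fin N) : Finset (Fin N) :=
  Finset.univ.filter fun m => m ≠ i ∧ m ≠ j ∧
    if m < i ∨ j < m then tripleY k θ₀ t i j m < tripleY k θ₀ t i j r
    -- The inequality is weak: an inner `r` sinks at its own triple point and is still above just
    -- before it.
    else tripleY k θ₀ t i j r ≤ tripleY k θ₀ t i j m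

open Classical in
/-- The bounded edges, indexed by their lines and their upper endpoints. -/
noncomputable def edgeIndices (k θ₀ : Fin N → ℝ) (t : ℝ) (M : ℕ) :
    Finset (Fin N × Fin N × Fin N) :=
  Finset.univ.filter fun x => x.1 < x.2.1 ∧ (x.2.2 ≠ x.1 ∧ x.2.2 ≠ x.2.1) ∧
    (aboveBefore k θ₀ t x.1 x.2.1 x.2.2).card + 1 = M ∧
    ∃ m, (m ≠ x.1 ∧ m ≠ x.2.1) ∧ tripleY k θ₀ t x.1 x.2.1 m < tripleY k θ₀ t x.1 x.2.1 x.2.2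

theorem mem_aboveBefore {i j r m : Fin N} : m ∈ aboveBefore k θ₀ t i j r ↔ m ≠ i ∧ m ≠ j ∧
    if m < i ∨ j < m then tripleY k θ₀ t i j m < tripleY k θ₀ t i j r
    else tripleY k θ₀ t i j r ≤ tripleY k θ₀ t i j m := by
  simp [aboveBefore]

theorem nonempty_cell_aboveBefore (hk : StrictMono k) {i j : Fin N} (hij : i < j) (r : Fin N) :
    (cell k θ₀ t (aboveBefore k θ₀ t i j r) i j).Nonempty := by
  have h : ∀ᶠ y in 𝓝[<] tripleY k θ₀ t i j r, ∀ m,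
      tripleY k θ₀ t i j m < tripleY k θ₀ t i j r → tripleY k θ₀ t i j m < y := by
    refine eventually_all.2 fun m => ?_
    by_cases hm : tripleY k θ₀ t i j m < tripleY k θ₀ t i j r
    · filter_upwards [Ioo_mem_nhdsLT hm] with y hy _
      exact hy.1
    · exact Eventually.of_forall fun y h => absurd h hm
  obtain ⟨y, hy, hyr⟩ := (h.and self_mem_nhdsWithin).exists
  refine ⟨linePt k θ₀ t i j y, phaseAt_linePt hk.injective hij.ne y, fun m hm => ?_,
    fun m hm hmi hmj => ?_⟩
  · obtain ⟨hmi, hmj, h⟩ := mem_aboveBefore.1 hm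
    rw [phaseAt_lt_linePt_iff hk hij hmi hmj]
    split_ifs at h ⊢
    · exact hy m h
    · exact lt_of_lt_of_le hyr h
  · rw [linePt_phaseAt_lt_iff hk hij hmi hmj]
    rw [mem_aboveBefore] at hm
    split_ifs at hm ⊢
    · exact lt_of_lt_of_le hyr (not_lt.1 fun h => hm ⟨hmi, hmj, h⟩)
    · exact hy m (not_le.1 fun h => hm ⟨hmi, hmj, h⟩)

/-- Each `m` cuts the line to a half-line in `y`: rising phases in `A` and sinking ones outside `A`
bound `y` from below, the others from above. -/
theorem mem_cell_iff (hk : StrictMono k) {i j : Fin N} (hij : i < j) {A : Finset (Fin N)}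
    (hi : i ∉ A) (hj : j ∉ A) (y : ℝ) :
    linePt k θ₀ t i j y ∈ cell k θ₀ t A i j ↔ ∀ m, m ≠ i → m ≠ j →
      if (m < i ∨ j < m) ↔ m ∈ A then tripleY k θ₀ t i j m < y
      else y < tripleY k θ₀ t i j m := by
  constructor
  · rintro ⟨-, h1, h2⟩ m hmi hmj
    by_cases hmA : m ∈ A
    · have := (phaseAt_lt_linePt_iff hk hij hmi hmj y).1 (h1 m hmA)
      simpa only [hmA, iff_true] using this
    · have := (linePt_phaseAt_lt_iff hk hij hmi hmj y).1 (h2 m hmA hmi hmj)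
      by_cases ho : m < i ∨ j < m <;> simpa only [hmA, ho, iff_false, not_true, not_false_iff,
        if_true, if_false] using this
  · intro h
    refine ⟨phaseAt_linePt hk.injective hij.ne y, fun m hm => ?_, fun m hm hmi hmj => ?_⟩
    · have hmi : m ≠ i := fun h => hi (h ▸ hm)
      have hmj : m ≠ j := fun h => hj (h ▸ hm)
      have := h m hmi hmj
      rw [phaseAt_lt_linePt_iff hk hij hmi hmj]
      simpa only [hm, iff_true] using this
    · have := h m hmi hmj
      rw [linePt_phaseAt_lt_iff hk hij hmi hmj]
      by_cases ho : m < i ∨ j < m <;> simpa only [hm, ho, iff_false, not_true, not_false_iff,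
        if_true, if_false] using this

theorem isBounded_cell_aboveBefore (hk : StrictMono k) {i j r m : Fin N} (hij : i < j)
    (hri : r ≠ i) (hrj : r ≠ j) (hmi : m ≠ i) (hmj : m ≠ j)
    (hm : tripleY k θ₀ t i j m < tripleY k θ₀ t i j r) :
    Bornology.IsBounded (cell k θ₀ t (aboveBefore k θ₀ t i j r) i j) := by
  have hi : i ∉ aboveBefore k θ₀ t i j r := fun h => (mem_aboveBefore.1 h).1 rfl
  have hj : j ∉ aboveBefore k θ₀ t i j r := fun h => (mem_aboveBefore.1 h).2.1 rfl
  have hcpt : IsCompact (linePt k θ₀ t i j ''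
      Set.Icc (tripleY k θ₀ t i j m) (tripleY k θ₀ t i j r)) :=
    isCompact_Icc.image (continuous_linePt i j)
  refine hcpt.isBounded.subset fun p hp => ?_
  have hpl := (phaseAt_eq_iff hk.injective hij.ne p).1 hp.1
  rw [hpl, mem_cell_iff hk hij hi hj] at hp
  refine ⟨p.2, ⟨?_, ?_⟩, hpl.symm⟩
  · have h := hp m hmi hmj
    rw [if_pos] at h
    · exact h.le
    · by_cases ho : m < i ∨ j < m
      · simpa [ho, mem_aboveBefore, hmi, hmj] using hm
      · simpa [ho, mem_aboveBefore, hmi, hmj] using hm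
  · have h := hp r hri hrj
    rw [if_neg] at h
    · exact h.le
    · by_cases ho : r < i ∨ j < r
      · simp [ho, mem_aboveBefore]
      · simp [ho, mem_aboveBefore, hri, hrj]

theorem exists_eq_aboveBefore (hk : StrictMono k) {i j : Fin N} (hij : i < j)
    {A : Finset (Fin N)} (hne : (cell k θ₀ t A i j).Nonempty)
    (hb : Bornology.IsBounded (cell k θ₀ t A i j)) :
    ∃ r, (r ≠ i ∧ r ≠ j) ∧ A = aboveBefore k θ₀ t i j r ∧
      ∃ m, (m ≠ i ∧ m ≠ j) ∧ tripleY k θ₀ t i j m < tripleY k θ₀ t i j r := by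
  obtain ⟨p, hp⟩ := hne
  have hi : i ∉ A := fun h => lt_irrefl _ (hp.2.1 i h)
  have hj : j ∉ A := fun h => (hp.2.1 j h).ne hp.1
  have hpl := (phaseAt_eq_iff hk.injective hij.ne p).1 hp.1
  rw [hpl, mem_cell_iff hk hij hi hj] at hp
  obtain ⟨R, hR⟩ := hb.exists_norm_le
  have hbd : ∀ y, linePt k θ₀ t i j y ∈ cell k θ₀ t A i j → |y| ≤ R := fun y hy =>
    (norm_snd_le (linePt k θ₀ t i j y)).trans (hR _ hy)
  have hup : ∃ m, (m ≠ i ∧ m ≠ j) ∧ p.2 < tripleY k θ₀ t i j m := by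
    by_contra! hcon
    -- Without an upper constraint the cell contains points of the line with ordinate beyond its
    -- norm bound `R`.
    have hy : linePt k θ₀ t i j (max p.2 (R + 1)) ∈ cell k θ₀ t A i j := by
      rw [mem_cell_iff hk hij hi hj]
      intro m hmi hmj
      have h1 := hp m hmi hmj
      split_ifs at h1 ⊢
      · exact lt_of_lt_of_le h1 (le_max_left _ _)
      · exact absurd h1 (not_lt.2 (hcon m ⟨hmi, hmj⟩))
    have := (le_abs_self _).trans (hbd _ hy)
    have := le_max_right p.2 (R + 1)
    linarith
  have hdown : ∃ m, (m ≠ i ∧ m ≠ j) ∧ tripleY k θ₀ t i j m < p.2 := by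
    by_contra! hcon
    have hy : linePt k θ₀ t i j (min p.2 (-R - 1)) ∈ cell k θ₀ t A i j := by
      rw [mem_cell_iff hk hij hi hj]
      intro m hmi hmj
      have h1 := hp m hmi hmj
      split_ifs at h1 ⊢
      · exact absurd h1 (not_lt.2 (hcon m ⟨hmi, hmj⟩))
      · exact lt_of_le_of_lt (min_le_left _ _) h1
    have := (neg_le_abs _).trans (hbd _ hy)
    have := min_le_right p.2 (-R - 1)
    linarith
  obtain ⟨m₀, hm₀, hlt₀⟩ := hup
  -- `r` is the first triple point met above `p`, hence the upper endpoint of the cell.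
  obtain ⟨r, hr, hmin⟩ := Finset.exists_min_image
    (Finset.univ.filter fun m => (m ≠ i ∧ m ≠ j) ∧ p.2 < tripleY k θ₀ t i j m)
    (tripleY k θ₀ t i j) ⟨m₀, by simpa using ⟨hm₀, hlt₀⟩⟩
  simp only [Finset.mem_filter, Finset.mem_univ, true_and] at hr hmin
  obtain ⟨m₁, hm₁, hlt₁⟩ := hdown
  refine ⟨r, hr.1, ?_, m₁, hm₁, hlt₁.trans hr.2⟩
  ext m
  rw [mem_aboveBefore]
  by_cases hmi : m = i
  · subst hmi; simp [hi]
  by_cases hmj : m = j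
  · subst hmj; simp [hj]
  have h1 := hp m hmi hmj
  have h2 := hmin m
  by_cases hmA : m ∈ A <;> by_cases ho : m < i ∨ j < m <;>
    simp only [hmA, ho, true_iff, false_iff, not_true, not_false_iff, if_true, if_false, iff_true,
      iff_false, Ne, hmi, hmj, true_and] at h1 h2 ⊢
  · exact h1.trans hr.2
  · exact h2 h1
  · exact not_lt.2 (h2 h1)
  · exact not_le.2 (h1.trans hr.2)

/-- Testing whether `r` itself belongs to both sets gives one inequality between the ordinates, and
testing `r'` gives the other; genericity then excludes `r ≠ r'`. -/
theorem aboveBefore_injective (hk : Function.Injective k) (hg : IsGeneric k θ₀ t)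
    {i j r r' : Fin N} (hij : i ≠ j) (hri : r ≠ i) (hrj : r ≠ j) (hri' : r' ≠ i) (hrj' : r' ≠ j)
    (h : aboveBefore k θ₀ t i j r = aboveBefore k θ₀ t i j r') : r = r' := by
  have hle : ∀ {r r' : Fin N}, r ≠ i → r ≠ j →
      aboveBefore k θ₀ t i j r = aboveBefore k θ₀ t i j r' →
      tripleY k θ₀ t i j r' ≤ tripleY k θ₀ t i j r := by
    intro r r' hri hrj h
    have h1 : r ∈ aboveBefore k θ₀ t i j r ↔ r ∈ aboveBefore k θ₀ t i j r' := by rw [h]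
    rw [mem_aboveBefore, mem_aboveBefore] at h1
    by_cases ho : r < i ∨ j < r <;> simpa [hri, hrj, ho] using h1
  by_contra hne
  exact tripleY_ne_of_isGeneric hk hg hij hri hrj hri' hrj' hne
    (le_antisymm (hle hri' hrj' h.symm) (hle hri hrj h))

theorem ncard_intermediateSolitons (hk : StrictMono k) (hM : M ≤ N) (hg : IsGeneric k θ₀ t) :
    (intermediateSolitons (graph k M θ₀ t)).Finite ∧
      (intermediateSolitons (graph k M θ₀ t)).ncard = (edgeIndices k θ₀ t M).card := by
  have himage : intermediateSolitons (graph k M θ₀ t) =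
      (fun x : Fin N × Fin N × Fin N =>
        cell k θ₀ t (aboveBefore k θ₀ t x.1 x.2.1 x.2.2) x.1 x.2.1) ''
        (edgeIndices k θ₀ t M : Set (Fin N × Fin N × Fin N)) := by
    ext e
    simp only [intermediateSolitons, Set.mem_ofPred_eq, mem_edges_iff hk.injective hM hg]
    constructor
    · rintro ⟨⟨A, i, j, hij, hA, hne, rfl⟩, hb⟩
      obtain ⟨r, hr, rfl, hm⟩ := exists_eq_aboveBefore hk hij hne hb
      refine ⟨(i, j, r), ?_, rfl⟩
      simp only [edgeIndices, Finset.coe_filter, Finset.mem_univ, true_and, Set.mem_ofPred_eq]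
      exact ⟨hij, hr, hA, hm⟩
    · rintro ⟨⟨i, j, r⟩, hx, rfl⟩
      simp only [edgeIndices, Finset.coe_filter, Finset.mem_univ, true_and,
        Set.mem_ofPred_eq] at hx
      obtain ⟨hij, hr, hA, m, hm, hlt⟩ := hx
      exact ⟨⟨_, i, j, hij, hA, nonempty_cell_aboveBefore hk hij r, rfl⟩,
        isBounded_cell_aboveBefore hk hij hr.1 hr.2 hm.1 hm.2 hlt⟩
  have hinj : Set.InjOn (fun x : Fin N × Fin N × Fin N =>
      cell k θ₀ t (aboveBefore k θ₀ t x.1 x.2.1 x.2.2) x.1 x.2.1)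
      (edgeIndices k θ₀ t M : Set (Fin N × Fin N × Fin N)) := by
    rintro ⟨i, j, r⟩ hx ⟨i', j', r'⟩ hx' heq
    simp only [edgeIndices, Finset.coe_filter, Finset.mem_univ, true_and, Set.mem_ofPred_eq]
      at hx hx' heq
    obtain ⟨p, hp⟩ := nonempty_cell_aboveBefore (θ₀ := θ₀) (t := t) hk hx.1 r
    obtain ⟨hA, rfl, rfl⟩ := cell_index_unique hx.1 hx'.1
      (by have := hx.2.2.1; have := hx'.2.2.1; omega) hp (heq ▸ hp)
    rw [aboveBefore_injective hk.injective hg hx.1.ne hx.2.1.1 hx.2.1.2 hx'.2.1.1 hx'.2.1.2 hA]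
  rw [himage, hinj.ncard_image, Set.ncard_coe_finset]
  exact ⟨(Finset.finite_toSet _).image _, rfl⟩

end Indexing

/-! ### Counting triples by level, then vertices and edges -/

section Counting

/-- Moving along a line from `-∞` to `+∞`, past finitely many distinct points at each of which a
counter goes up or down by one, telescopes. -/
theorem sum_level_differences {ι : Type*} [DecidableEq ι] (y : ι → ℝ) (up : ι → Prop)
    [DecidablePred up] (R : Finset ι) : Set.InjOn y R → ∀ F : ℕ → ℤ,
    ∑ r ∈ R, (if up r then
        F ((R.filter fun m => if up m then y m < y r else y r < y m).card + 1) -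
          F (R.filter fun m => if up m then y m < y r else y r < y m).card
      else -(F ((R.filter fun m => if up m then y m < y r else y r < y m).card + 1) -
          F (R.filter fun m => if up m then y m < y r else y r < y m).card)) =
      F (R.filter up).card - F (R.filter fun m => ¬ up m).card := by
  -- Remove the topmost point `a`. If it is `up`, it affects no lower counter; otherwise it raises
  -- each of them by one, and the induction hypothesis is applied to the shifted `F`.
  induction R using Finset.induction_on_max_value y with
  | empty => simp
  | insert a s ha hmax ih =>
    intro hinj F
    have hlt : ∀ x ∈ s, y x < y a := fun x hx => lt_of_le_of_ne (hmax x hx) fun h =>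
      ha (hinj (by simp [hx]) (by simp) h ▸ hx)
    have hinj' : Set.InjOn y s := hinj.mono (by simp)
    have hca : ((insert a s).filter fun m => if up m then y m < y a else y a < y m) =
        s.filter up := by
      ext m
      simp only [Finset.mem_filter, Finset.mem_insert]
      constructor
      · rintro ⟨rfl | hm, h⟩
        · simp at h
        · split_ifs at h with hu
          · exact ⟨hm, hu⟩
          · exact absurd h (lt_asymm (hlt m hm))
      · rintro ⟨hm, hu⟩
        exact ⟨Or.inr hm, by simpa [hu] using hlt m hm⟩
    rw [Finset.sum_insert ha, hca]
    by_cases hua : up a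
    · have hcr : ∀ r ∈ s, ((insert a s).filter fun m => if up m then y m < y r else y r < y m) =
          s.filter fun m => if up m then y m < y r else y r < y m := fun r hr => by
        rw [Finset.filter_insert, if_neg]
        simpa [hua] using (hlt r hr).le
      rw [Finset.sum_congr rfl fun r hr => by rw [hcr r hr], ih hinj' F, if_pos hua,
        Finset.filter_insert, if_pos hua, Finset.filter_insert, if_neg (by simpa using hua),
        Finset.card_insert_of_notMem (by simp [ha])]
      ring
    · have hcr : ∀ r ∈ s,
          ((insert a s).filter fun m => if up m then y m < y r else y r < y m).card =
          (s.filter fun m => if up m then y m < y r else y r < y m).card + 1 := fun r hr => by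
        rw [Finset.filter_insert, if_pos, Finset.card_insert_of_notMem (by simp [ha])]
        simpa [hua] using hlt r hr
      rw [Finset.sum_congr rfl fun r hr => by rw [hcr r hr], ih hinj' fun n => F (n + 1),
        if_neg hua, Finset.filter_insert, if_neg hua, Finset.filter_insert, if_pos hua,
        Finset.card_insert_of_notMem (by simp [ha])]
      ring

variable {N M : ℕ}

/-- The sum of `H` over increasing triples. -/
def tripleSum (H : Fin N → Fin N → Fin N → ℤ) : ℤ :=
  ∑ a, ∑ b, ∑ c, if a < b ∧ b < c then H a b c else 0

/-- The indices other than `i` and `j`. -/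
def others (i j : Fin N) : Finset (Fin N) := Finset.univ.filter fun m => m ≠ i ∧ m ≠ j

/-- A triple `a < b < c` lies on three lines: its third index is outer for `(a, b)` and `(b, c)`,
and inner for `(a, c)`. -/
theorem sum_pairs_others (f g : Fin N → Fin N → Fin N → ℤ)
    (hf₁ : ∀ i j l, i ≠ j → l ≠ i → l ≠ j → f j i l = f i j l)
    (hf₂ : ∀ i j l, i ≠ j → l ≠ i → l ≠ j → f i l j = f i j l)
    (hg₂ : ∀ i j l, i ≠ j → l ≠ i → l ≠ j → g i l j = g i j l) :
    ∑ i, ∑ j, (if i < j then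
      ∑ r ∈ others i j, (if r < i ∨ j < r then f i j r else g i j r) else 0) =
      2 * tripleSum f + tripleSum g := by
  have h1 : ∀ i j : Fin N, (if i < j then
      ∑ r ∈ others i j, (if r < i ∨ j < r then f i j r else g i j r) else 0) =
      ∑ r, ((if r < i ∧ i < j then f r i j else 0) + (if i < j ∧ j < r then f i j r else 0) +
        (if i < r ∧ r < j then g i r j else 0)) := by
    intro i j
    split_ifs with hij
    · rw [others, Finset.sum_filter]
      refine Finset.sum_congr rfl fun r _ => ?_
      rcases lt_trichotomy r i with h | h | h
      · have e : f r i j = f i j r := by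
          rw [hf₁ i r j h.ne' hij.ne' (h.trans hij).ne', hf₂ i j r hij.ne h.ne (h.trans hij).ne]
        simp [h, hij, h.ne, (h.trans hij).ne, h.not_gt, (h.trans hij).not_gt, e]
      · subst h; simp [hij.not_gt]
      · rcases lt_trichotomy r j with h' | h' | h'
        · have e := hg₂ i j r hij.ne h.ne' h'.ne
          simp [h, h', hij, h.ne', h'.ne, h.not_gt, h'.not_gt, e]
        · subst h'; simp [h.not_gt]
        · simp [h, h', hij, h.ne', h'.ne', h.not_gt, h'.not_gt]
    · refine (Finset.sum_eq_zero fun r _ => ?_).symm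
      rw [if_neg, if_neg, if_neg] <;> simp <;> intros <;> omega
  have e1 : ∑ i : Fin N, ∑ j : Fin N, ∑ r : Fin N, (if r < i ∧ i < j then f r i j else 0) =
      tripleSum f :=
    (Finset.sum_congr rfl fun i _ => Finset.sum_comm).trans Finset.sum_comm
  have e3 : ∑ i : Fin N, ∑ j : Fin N, ∑ r : Fin N, (if i < r ∧ r < j then g i r j else 0) =
      tripleSum g := Finset.sum_congr rfl fun i _ => Finset.sum_comm
  simp only [h1, Finset.sum_add_distrib]
  rw [e1, e3, two_mul]
  rfl

theorem sum_pairs_at_distance {d : ℕ} (hd : d ≤ N) :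
    ∑ i : Fin N, ∑ j : Fin N, (if (j : ℕ) = i + d then (1 : ℤ) else 0) = N - d := by
  have h1 : ∀ i : Fin N, ∑ j : Fin N, (if (j : ℕ) = i + d then (1 : ℤ) else 0) =
      if (i : ℕ) + d < N then 1 else 0 := fun i => by
    rw [Fin.sum_univ_eq_sum_range (fun j => if j = (i : ℕ) + d then (1 : ℤ) else 0)]
    simp
  simp only [h1]
  rw [Fin.sum_univ_eq_sum_range (fun i => if i + d < N then (1 : ℤ) else 0), Finset.sum_boole]
  have h2 : (Finset.range N).filter (fun i => i + d < N) = Finset.range (N - d) := by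
    ext i
    simp only [Finset.mem_filter, Finset.mem_range]
    omega
  rw [h2, Finset.card_range, Nat.cast_sub hd]

/-- As `y → -∞` the phases above the line are the inner ones, as `y → +∞` the outer ones; the two
cardinalities are the end values of the counter. -/
theorem card_others_inside {i j : Fin N} :
    ((others i j).filter fun m => ¬ (m < i ∨ j < m)).card = (j : ℕ) - i - 1 := by
  rw [← Fin.card_Ioo]
  congr 1
  ext m
  simp only [others, Finset.mem_filter, Finset.mem_univ, true_and, Finset.mem_Ioo]
  omega

theorem card_others_outside {i j : Fin N} (hij : i < j) :
    ((others i j).filter fun m => m < i ∨ j < m).card = i + (N - 1 - j) := by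
  have h : (others i j).filter (fun m => m < i ∨ j < m) = Finset.Iio i ∪ Finset.Ioi j := by
    ext m
    simp only [others, Finset.mem_filter, Finset.mem_univ, true_and, Finset.mem_union,
      Finset.mem_Iio, Finset.mem_Ioi]
    omega
  rw [h, Finset.card_union_of_disjoint, Fin.card_Iio, Fin.card_Ioi]
  rw [Finset.disjoint_left]
  intro m
  simp only [Finset.mem_Iio, Finset.mem_Ioi]
  omega

variable {k θ₀ : Fin N → ℝ} {t : ℝ}

theorem above_triplePt (hk : StrictMono k) {i j r : Fin N} (hij : i < j) :
    above k θ₀ t (triplePt k θ₀ t i j r) i = (others i j).filter fun m =>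
      if m < i ∨ j < m then tripleY k θ₀ t i j m < tripleY k θ₀ t i j r
      else tripleY k θ₀ t i j r < tripleY k θ₀ t i j m := by
  ext m
  simp only [mem_above, others, Finset.mem_filter, Finset.mem_univ, true_and]
  constructor
  · intro h
    have hmi : m ≠ i := by rintro rfl; exact lt_irrefl _ h
    have hmj : m ≠ j := by rintro rfl; exact h.ne (phaseAt_linePt hk.injective hij.ne _)
    exact ⟨⟨hmi, hmj⟩, (phaseAt_lt_linePt_iff hk hij hmi hmj _).1 h⟩
  · rintro ⟨⟨hmi, hmj⟩, h⟩
    exact (phaseAt_lt_linePt_iff hk hij hmi hmj _).2 h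

theorem injOn_tripleY (hk : Function.Injective k) (hg : IsGeneric k θ₀ t) {i j : Fin N}
    (hij : i ≠ j) : Set.InjOn (tripleY k θ₀ t i j) (others i j) := by
  intro l hl m hm heq
  simp only [others, Finset.coe_filter, Finset.mem_univ, true_and, Set.mem_ofPred_eq] at hl hm
  by_contra hne
  exact tripleY_ne_of_isGeneric hk hg hij hl.1 hl.2 hm.1 hm.2 hne heq

/-- Just below the triple point an outer `r` has not yet risen above the line, whereas an inner `r`
has not yet sunk. -/
theorem card_aboveBefore (hk : StrictMono k) (hg : IsGeneric k θ₀ t) {i j r : Fin N} (hij : i < j)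
    (hr : r ∈ others i j) :
    (aboveBefore k θ₀ t i j r).card =
      if r < i ∨ j < r then level k θ₀ t i j r else level k θ₀ t i j r + 1 := by
  have hr' : r ≠ i ∧ r ≠ j := (Finset.mem_filter.1 hr).2
  have hinj := injOn_tripleY hk.injective hg hij.ne
  have hle : ∀ m, m ≠ i → m ≠ j → m ≠ r →
      (tripleY k θ₀ t i j r ≤ tripleY k θ₀ t i j m ↔
        tripleY k θ₀ t i j r < tripleY k θ₀ t i j m) := fun m hmi hmj hmr =>
    ⟨fun h => lt_of_le_of_ne h fun e => hmr (hinj (by simp [others, hmi, hmj]) hr e.symm), le_of_lt⟩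
  rw [level, above_triplePt hk hij]
  split_ifs with ho
  · congr 1
    ext m
    rw [mem_aboveBefore]
    simp only [others, Finset.mem_filter, Finset.mem_univ, true_and, ← and_assoc]
    refine and_congr_right fun hm => ?_
    split_ifs with hom
    · rfl
    · exact hle m hm.1 hm.2 fun h => hom (h ▸ ho)
  · have hnot : r ∉ (others i j).filter fun m =>
        if m < i ∨ j < m then tripleY k θ₀ t i j m < tripleY k θ₀ t i j r
        else tripleY k θ₀ t i j r < tripleY k θ₀ t i j m := by
      simp
    rw [← Finset.card_insert_of_notMem hnot]
    congr 1
    ext m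
    rw [mem_aboveBefore]
    simp only [others, Finset.mem_insert, Finset.mem_filter, Finset.mem_univ, true_and,
      ← and_assoc]
    by_cases hmr : m = r
    · subst hmr; simp [hr', ho]
    · rw [or_iff_right hmr]
      refine and_congr_right fun hm => ?_
      split_ifs with hom
      · rfl
      · exact hle m hm.1 hm.2 hmr

/-- The number of triples whose common point lies below exactly `b - 1` other phases. -/
noncomputable def tripleCount (k θ₀ : Fin N → ℝ) (t : ℝ) (b : ℕ) : ℤ :=
  tripleSum fun i j l => if level k θ₀ t i j l + 1 = b then 1 else 0

theorem tripleSum_sub (f g : Fin N → Fin N → Fin N → ℤ) :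
    tripleSum (fun i j l => f i j l - g i j l) = tripleSum f - tripleSum g := by
  simp only [tripleSum, ← Finset.sum_sub_distrib]
  refine Finset.sum_congr rfl fun i _ => Finset.sum_congr rfl fun j _ =>
    Finset.sum_congr rfl fun l _ => ?_
  split_ifs <;> simp

theorem tripleSum_neg (f : Fin N → Fin N → Fin N → ℤ) :
    tripleSum (fun i j l => -f i j l) = -tripleSum f := by
  have := tripleSum_sub (fun _ _ _ => 0) f
  simpa [tripleSum] using this

/-- Telescope the indicator `F` of `b` along every line. The triples contribute `2 - 1 = 1` times
`T_b - T_{b+1}`. The line ends contribute the pairs at distance `N - 1 - b` minus those at distance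
`b + 1`, that is `(b + 1) - (N - b - 1)`. -/
theorem tripleCount_succ (hk : StrictMono k) (hg : IsGeneric k θ₀ t) {b : ℕ} (hb : b + 2 ≤ N) :
    tripleCount k θ₀ t (b + 1) = tripleCount k θ₀ t b + (N - 2 - 2 * b) := by
  set F : ℕ → ℤ := fun x => if x = b then 1 else 0 with hF
  set f : Fin N → Fin N → Fin N → ℤ := fun i j l =>
    F (level k θ₀ t i j l + 1) - F (level k θ₀ t i j l) with hf
  have hf₁ : ∀ i j l, i ≠ j → l ≠ i → l ≠ j → f j i l = f i j l := fun i j l h1 h2 h3 => by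
    simp only [hf, level_swap hk.injective h1 h2 h3]
  have hf₂ : ∀ i j l, i ≠ j → l ≠ i → l ≠ j → f i l j = f i j l := fun i j l h1 h2 h3 => by
    simp only [hf, level_rotate hk.injective h1 h2 h3]
  have h1 := sum_pairs_others f (fun i j l => -f i j l) hf₁ hf₂
    fun i j l h1 h2 h3 => by rw [hf₂ i j l h1 h2 h3]
  have h2 : ∀ i j : Fin N, (if i < j then
      ∑ r ∈ others i j, (if r < i ∨ j < r then f i j r else -f i j r) else 0) =
      (if (j : ℕ) = i + (N - 1 - b) then (1 : ℤ) else 0) -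
        if (j : ℕ) = i + (b + 1) then 1 else 0 := by
    intro i j
    by_cases hij : i < j
    · have h3 := sum_level_differences (tripleY k θ₀ t i j) (fun r => r < i ∨ j < r) (others i j)
        (injOn_tripleY hk.injective hg hij.ne) F
      simp only [hf, level, above_triplePt hk hij]
      rw [if_pos hij, h3, card_others_inside, card_others_outside hij, hF]
      simp only
      congr 1 <;> refine if_congr ?_ rfl rfl <;> omega
    · rw [if_neg hij, if_neg (by omega), if_neg (by omega), sub_zero]
  simp only [h2, Finset.sum_sub_distrib] at h1
  rw [sum_pairs_at_distance (by omega), sum_pairs_at_distance (by omega), tripleSum_neg] at h1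
  have h4 : tripleSum f = tripleCount k θ₀ t b - tripleCount k θ₀ t (b + 1) := by
    rw [tripleCount, tripleCount, ← tripleSum_sub]
    simp only [hf, hF, Nat.add_right_cancel_iff]
  rw [h4] at h1
  push_cast [Nat.cast_sub (show b ≤ N - 1 by omega), Nat.cast_sub (show 1 ≤ N by omega)] at h1
  linarith

theorem tripleCount_eq (hk : StrictMono k) (hg : IsGeneric k θ₀ t) {b : ℕ} (hb : b + 1 ≤ N) :
    tripleCount k θ₀ t b = b * (N - 1 - b) := by
  induction b with
  -- No level satisfies `level + 1 = 0`.
  | zero => simp [tripleCount, tripleSum]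
  | succ b ih =>
    rw [tripleCount_succ hk hg (by omega), ih (by omega)]
    push_cast
    ring

theorem card_vertexIndices (hM : 1 ≤ M) :
    ((vertexIndices k θ₀ t M).card : ℤ) =
      tripleCount k θ₀ t M + tripleCount k θ₀ t (M - 1) := by
  classical
  rw [vertexIndices, Finset.card_filter]
  push_cast
  simp only [Fintype.sum_prod_type, tripleCount, tripleSum, ← Finset.sum_add_distrib]
  refine Finset.sum_congr rfl fun i _ => Finset.sum_congr rfl fun j _ =>
    Finset.sum_congr rfl fun l _ => ?_
  by_cases h : i < j ∧ j < l
  · simp only [h.1, h.2, true_and, and_self, if_true]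
    split_ifs <;> first | rfl | omega
  · rw [if_neg fun h' => h ⟨h'.1, h'.2.1⟩, if_neg h, if_neg h, add_zero]

/-- The existential condition fails only for the lowest triple point of the line, below which lies a
ray with the `j - i - 1` inner phases above. `3 ≤ N` ensures that such a point exists. -/
theorem sum_others_bounded (hk : StrictMono k) (hg : IsGeneric k θ₀ t) (hN : 3 ≤ N)
    {i j : Fin N} (hij : i < j)
    [DecidablePred fun r => ∃ m, (m ≠ i ∧ m ≠ j) ∧ tripleY k θ₀ t i j m < tripleY k θ₀ t i j r] :
    ∑ r ∈ others i j, (if (aboveBefore k θ₀ t i j r).card + 1 = M ∧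
      ∃ m, (m ≠ i ∧ m ≠ j) ∧ tripleY k θ₀ t i j m < tripleY k θ₀ t i j r then (1 : ℤ) else 0) =
    ∑ r ∈ others i j, (if (aboveBefore k θ₀ t i j r).card + 1 = M then (1 : ℤ) else 0) -
      if (j : ℕ) = i + M then 1 else 0 := by
  have hne : (others i j).Nonempty := by
    rw [← Finset.card_pos]
    have h1 : others i j = ({i, j} : Finset (Fin N))ᶜ := by
      ext m
      simp [others]
    rw [h1, Finset.card_compl, Finset.card_pair hij.ne, Fintype.card_fin]
    omega
  obtain ⟨r₀, hr₀, hmin⟩ := Finset.exists_min_image (others i j) (tripleY k θ₀ t i j) hne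
  have hmin' : ∀ m, m ≠ i ∧ m ≠ j → tripleY k θ₀ t i j r₀ ≤ tripleY k θ₀ t i j m := fun m hm =>
    hmin m (by simpa [others] using hm)
  have hr₀' : r₀ ≠ i ∧ r₀ ≠ j := (Finset.mem_filter.1 hr₀).2
  have hcard : (aboveBefore k θ₀ t i j r₀).card = (j : ℕ) - i - 1 := by
    rw [← card_others_inside]
    congr 1
    ext m
    simp only [mem_aboveBefore, others, Finset.mem_filter, Finset.mem_univ, true_and, ← and_assoc]
    refine and_congr_right fun hm => ?_
    split_ifs with ho
    · simpa [ho] using hmin' m hm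
    · simpa [ho] using hmin' m hm
  rw [← Finset.add_sum_erase _ _ hr₀, ← Finset.add_sum_erase _ _ hr₀, hcard,
    if_neg (by rintro ⟨-, m, hm, hlt⟩; exact absurd hlt (not_lt.2 (hmin' m hm)))]
  have h1 : ((j : ℕ) - i - 1 + 1 = M) ↔ (j : ℕ) = i + M := by omega
  rw [if_congr h1 rfl rfl, zero_add, add_sub_cancel_left]
  refine Finset.sum_congr rfl fun r hr => if_congr (and_iff_left ⟨r₀, hr₀', ?_⟩) rfl rfl
  have hr' := Finset.mem_erase.1 hr
  exact lt_of_le_of_ne (hmin r hr'.2) fun h =>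
    hr'.1 (injOn_tripleY hk.injective hg hij.ne hr'.2 hr₀ h.symm)

/-- An edge ending at `r` from below has `M - 1` phases above, so the level of its endpoint is `M -
1` for outer `r` and `M - 2` for inner `r`. Subtracted are the rays unbounded below, one for each
pair with `j - i = M`. -/
theorem card_edgeIndices (hk : StrictMono k) (hg : IsGeneric k θ₀ t) (hN : 3 ≤ N) (hM : 1 ≤ M)
    (hMN : M ≤ N) :
    ((edgeIndices k θ₀ t M).card : ℤ) =
      2 * tripleCount k θ₀ t M + tripleCount k θ₀ t (M - 1) - (N - M) := by
  classical
  have hsym₁ : ∀ c : ℕ, ∀ i j l : Fin N, i ≠ j → l ≠ i → l ≠ j →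
      (if level k θ₀ t j i l + 1 = c then (1 : ℤ) else 0) =
        if level k θ₀ t i j l + 1 = c then 1 else 0 := fun c i j l h1 h2 h3 => by
    rw [level_swap hk.injective h1 h2 h3]
  have hsym₂ : ∀ c : ℕ, ∀ i j l : Fin N, i ≠ j → l ≠ i → l ≠ j →
      (if level k θ₀ t i l j + 1 = c then (1 : ℤ) else 0) =
        if level k θ₀ t i j l + 1 = c then 1 else 0 := fun c i j l h1 h2 h3 => by
    rw [level_rotate hk.injective h1 h2 h3]
  have h1 := sum_pairs_others
    (fun i j l => if level k θ₀ t i j l + 1 = M then (1 : ℤ) else 0)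
    (fun i j l => if level k θ₀ t i j l + 1 = M - 1 then (1 : ℤ) else 0)
    (hsym₁ M) (hsym₂ M) (hsym₂ (M - 1))
  rw [tripleCount, tripleCount, ← h1, ← sum_pairs_at_distance hMN, ← Finset.sum_sub_distrib,
    edgeIndices, Finset.card_filter]
  push_cast
  rw [Fintype.sum_prod_type]
  refine Finset.sum_congr rfl fun i _ => ?_
  rw [← Finset.sum_sub_distrib, Fintype.sum_prod_type]
  refine Finset.sum_congr rfl fun j _ => ?_
  by_cases hij : i < j
  · have h2 := sum_others_bounded (M := M) hk hg hN hij
    rw [if_pos hij]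
    have h3 : ∑ r ∈ others i j, (if (aboveBefore k θ₀ t i j r).card + 1 = M
        then (1 : ℤ) else 0) = ∑ r ∈ others i j, (if r < i ∨ j < r then
          if level k θ₀ t i j r + 1 = M then (1 : ℤ) else 0
          else if level k θ₀ t i j r + 1 = M - 1 then 1 else 0) := by
      refine Finset.sum_congr rfl fun r hr => ?_
      rw [card_aboveBefore hk hg hij hr]
      split_ifs <;> first | rfl | omega
    rw [← h3, ← h2, others, Finset.sum_filter]
    refine Finset.sum_congr rfl fun r _ => ?_
    simp only [hij, true_and]
    by_cases hr : r ≠ i ∧ r ≠ j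
    · simp only [hr, true_and, if_true, ne_eq, not_false_iff]
    · rw [if_neg fun h => hr h.1, if_neg hr]
  · rw [if_neg hij, if_neg (by omega), sub_zero]
    exact Finset.sum_eq_zero fun r _ => if_neg fun h => hij h.1

end Counting

/-! ### Genericity in time and in the phase constants -/

section Generic

variable {N : ℕ} {k : Fin N → ℝ}

/-- The second divided difference of the cube is `k i + k j + k l`, the speed of the triple point's
ordinate. -/
theorem tripleY_eq_add (hk : Function.Injective k) (θ₀ : Fin N → ℝ) (t : ℝ) {i j l : Fin N}
    (hij : i ≠ j) (hil : l ≠ i) (hjl : l ≠ j) :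
    tripleY k θ₀ t i j l = tripleY k θ₀ 0 i j l + (k i + k j + k l) * t := by
  have h1 : k j - k i ≠ 0 := sub_ne_zero.2 fun h => hij (hk h.symm)
  have h2 : k l - k i ≠ 0 := sub_ne_zero.2 fun h => hil (hk h)
  have h3 : k l - k j ≠ 0 := sub_ne_zero.2 fun h => hjl (hk h)
  have e1 : k i - k j = -(k j - k i) := by ring
  have e2 : k i - k l = -(k l - k i) := by ring
  have e3 : k j - k l = -(k l - k j) := by ring
  simp only [tripleY]
  rw [e1, e2, e3]
  field_simp
  ring

theorem finite_not_isGeneric (hk : Function.Injective k) (θ₀ : Fin N → ℝ) :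
    {t : ℝ | ¬ IsGeneric k θ₀ t}.Finite := by
  have hsub : {t : ℝ | ¬ IsGeneric k θ₀ t} ⊆ ⋃ (i : Fin N) (j : Fin N) (l : Fin N) (m : Fin N),
      {t : ℝ | (i < j ∧ j < l ∧ l < m) ∧ tripleY k θ₀ t i j l = tripleY k θ₀ t i j m} := by
    intro t ht
    rw [Set.mem_ofPred_eq, isGeneric_iff hk] at ht
    push Not at ht
    obtain ⟨i, j, l, m, hij, hjl, hlm, h⟩ := ht
    simp only [Set.mem_iUnion]
    exact ⟨i, j, l, m, ⟨hij, hjl, hlm⟩, h⟩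
  refine Set.Finite.subset (Set.finite_iUnion fun i => Set.finite_iUnion fun j =>
    Set.finite_iUnion fun l => Set.finite_iUnion fun m => Set.Subsingleton.finite ?_) hsub
  -- The ordinates of the two triple points have speeds differing by `k l - k m ≠ 0`, so they meet
  -- at most once.
  rintro t ⟨⟨hij, hjl, hlm⟩, h⟩ t' ⟨-, h'⟩
  rw [tripleY_eq_add hk θ₀ _ hij.ne (hij.trans hjl).ne' hjl.ne', tripleY_eq_add hk θ₀ _ hij.ne
    (hij.trans (hjl.trans hlm)).ne' (hjl.trans hlm).ne'] at h h'
  have h0 : (k l - k m) * (t - t') = 0 := by linear_combination h - h'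
  exact sub_eq_zero.1 ((mul_eq_zero.1 h0).resolve_left (sub_ne_zero.2 fun e => hlm.ne (hk e)))

theorem isOpen_isGeneric (hk : Function.Injective k) (t : ℝ) :
    IsOpen {θ₀ : Fin N → ℝ | IsGeneric k θ₀ t} := by
  have hcont : ∀ i j l, Continuous fun θ₀ : Fin N → ℝ => tripleY k θ₀ t i j l := by
    intro i j l
    unfold tripleY
    fun_prop
  simp only [isGeneric_iff hk, Set.ofPred_forall]
  refine isOpen_iInter_of_finite fun i => isOpen_iInter_of_finite fun j =>
    isOpen_iInter_of_finite fun l => isOpen_iInter_of_finite fun m =>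
    isOpen_iInter_of_finite fun _ => isOpen_iInter_of_finite fun _ =>
    isOpen_iInter_of_finite fun _ => ?_
  exact isOpen_ne_fun (hcont i j l) (hcont i j m)

theorem ae_isGeneric (hk : Function.Injective k) (t : ℝ) :
    ∀ᵐ θ₀ : Fin N → ℝ, IsGeneric k θ₀ t := by
  simp only [isGeneric_iff hk, eventually_all]
  intro i j l m hij hjl hlm
  -- Coincidence of two triple points is an affine condition on `θ₀`. It is proper because changing
  -- the coordinate `m` alone moves only the second one, and a proper affine subspace is null.
  let s : AffineSubspace ℝ (Fin N → ℝ) :=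
    { carrier := {θ₀ | tripleY k θ₀ t i j l = tripleY k θ₀ t i j m}
      smul_vsub_vadd_mem' := fun c p q r hp hq hr => by
        have hlin : ∀ a : Fin N, tripleY k (c • (p -ᵥ q) +ᵥ r) t i j a =
            c * (tripleY k p t i j a - tripleY k q t i j a) + tripleY k r t i j a := by
          intro a
          simp only [tripleY, vsub_eq_sub, vadd_eq_add, Pi.add_apply, Pi.smul_apply, Pi.sub_apply,
            smul_eq_mul]
          ring
        simp only [Set.mem_ofPred_eq] at hp hq hr ⊢
        rw [hlin, hlin, hp, hq, hr] }
  have hs : s ≠ ⊤ := by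
    intro htop
    have hmem : ∀ θ₀ : Fin N → ℝ, tripleY k θ₀ t i j l = tripleY k θ₀ t i j m := fun θ₀ => by
      have : θ₀ ∈ s := htop ▸ AffineSubspace.mem_top ℝ _ θ₀
      exact this
    have hmi : m ≠ i := (hij.trans (hjl.trans hlm)).ne'
    have hmj : m ≠ j := (hjl.trans hlm).ne'
    have h0 := hmem 0
    have h1 := hmem (Pi.single m 1)
    have h2 : (1 : ℝ) / ((k m - k i) * (k m - k j)) = 0 := by
      simp only [tripleY, Pi.single_eq_same, Pi.single_eq_of_ne hmi.symm,
        Pi.single_eq_of_ne hmj.symm, Pi.single_eq_of_ne hlm.ne, Pi.zero_apply] at h0 h1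
      linear_combination h1 - h0
    exact one_div_ne_zero (mul_ne_zero (sub_ne_zero.2 fun e => hmi (hk e))
      (sub_ne_zero.2 fun e => hmj (hk e))) h2
  have hnull := Measure.addHaar_affineSubspace (volume : Measure (Fin N → ℝ)) s hs
  rw [ae_iff]
  simp only [Ne, not_not]
  exact hnull

end Generic

end KPSoliton

/-! ### Assembly of the counts -/

theorem mainTheorem3 (Nm Np : ℕ) (hNm : 1 ≤ Nm) (hNp : 1 ≤ Np) (hN : 3 ≤ Nm + Np)
    (k : Fin (Nm + Np) → ℝ) (hk : StrictMono k) :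
    (∀ (θ₀ : Fin (Nm + Np) → ℝ) (t : ℝ), KPSoliton.IsGeneric k θ₀ t →
      (KPSoliton.vertices (KPSoliton.graph k Np θ₀ t)).Finite ∧
      ((KPSoliton.vertices (KPSoliton.graph k Np θ₀ t)).ncard : ℤ)
        = 2 * (Nm : ℤ) * (Np : ℤ) - ((Nm : ℤ) + (Np : ℤ)) ∧
      (KPSoliton.intermediateSolitons (KPSoliton.graph k Np θ₀ t)).Finite ∧
      ((KPSoliton.intermediateSolitons (KPSoliton.graph k Np θ₀ t)).ncard : ℤ)
        = 3 * (Nm : ℤ) * (Np : ℤ) - 2 * ((Nm : ℤ) + (Np : ℤ))) ∧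
    (∀ θ₀ : Fin (Nm + Np) → ℝ, {t : ℝ | ¬ KPSoliton.IsGeneric k θ₀ t}.Finite) ∧
    (∀ t : ℝ, IsOpen {θ₀ : Fin (Nm + Np) → ℝ | KPSoliton.IsGeneric k θ₀ t} ∧
      ∀ᵐ θ₀ : Fin (Nm + Np) → ℝ, KPSoliton.IsGeneric k θ₀ t) := by
  have hMN : Np ≤ Nm + Np := Nat.le_add_left _ _
  refine ⟨fun θ₀ t hg => ?_, KPSoliton.finite_not_isGeneric hk.injective, fun t =>
    ⟨KPSoliton.isOpen_isGeneric hk.injective t, KPSoliton.ae_isGeneric hk.injective t⟩⟩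
  obtain ⟨hvf, hvc⟩ := KPSoliton.ncard_vertices hk.injective hMN hg
  obtain ⟨hef, hec⟩ := KPSoliton.ncard_intermediateSolitons hk hMN hg
  -- The closed form needs `b + 1 ≤ N`, which for `b = Np` is `1 ≤ Nm`.
  have h1 := KPSoliton.tripleCount_eq hk hg (b := Np) (by omega)
  have h2 := KPSoliton.tripleCount_eq hk hg (b := Np - 1) (by omega)
  push_cast [Nat.cast_sub hNp] at h1 h2
  refine ⟨hvf, ?_, hef, ?_⟩
  · rw [hvc, KPSoliton.card_vertexIndices hNp, h1, h2]
    ring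
  · rw [hec, KPSoliton.card_edgeIndices hk hg hN hNp hMN, h1, h2]
    push_cast
    ring
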